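/- **Setting.** Let $d\ge 1$ be an integer and let $\mathbf W=\{W^n\}_{n\ge 1}$ be an arbitrary sequence of channels, where $W^n$ assigns to each element $x$ of a finite set $\mathcal X^n$ with $|\mathcal X^n|=d^n$ a (discrete) probability distribution $W^n_x$ on an arbitrary set $\mathcal Y^n$. No relation between the channels $W^n$ for different $n$ is assumed. For a channel $W:\mathcal X\to\mathcal Y$ and a distribution $p$ on $\mathcal X$ put $W_p(y)=\sum_x p(x)W_x(y)$, and let $d(q,q')=\sum_y|q(y)-q'(y)|$ be the variational distance. An *identification code* $\Phi$ for $W$ consists of an integer $N=|\Phi|\ge 1$, distributions $Q_1,\dots,Q_N$ on $\mathcal X$ and subsets $\mathcal D_1,\dots,\mathcal D_N\subset\mathcal Y$ (not necessarily disjoint); put $\mu(\Phi)=\max_i W_{Q_i}(\mathcal D_i^c)$ and $\lambda(\Phi)=\max_{i\ne j}W_{Q_j}(\mathcal D_i)$ (which is $0$ if $N=1$). Use the convention $\log\log 1:=0$. For $\mu>0$, $\lambda\ge 0$ define, with $\Phi_n$ ranging over identification codes for $W^n$, $$D(\mu,\lambda|\mathbf W)=\sup_{\{\Phi_n\}}\Big\{\liminf_{n\to\infty}\tfrac1n\log\log|\Phi_n|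 \ \Big|\ \limsup_{n\to\infty}\mu(\Phi_n)<\mu,\ \limsup_{n\to\infty}\lambda(\Phi_n)\le\lambda\Big\},$$ $$D^\dagger(\mu,\lambda|\mathbf W)=\sup_{\{\Phi_n\}}\Big\{\liminf_{n\to\infty}\tfrac1n\log\log|\Phi_n| \ \Big|\ \liminf_{n\to\infty}\mu(\Phi_n)<\mu,\ \limsup_{n\to\infty}\lambda(\Phi_n)\le\lambda\Big\};$$ for $\mu=0$ the condition on $\mu(\Phi_n)$ is replaced by $\limsup\mu(\Phi_n)=0$, respectively $\liminf\mu(\Phi_n)=0$. For real $L$ put $$\epsilon(L,W)=\max_{p}\ \min_{1\le M\le L;\ x_1,\dots,x_M\in\mathcal X} d\Big(\tfrac1M\sum_{i=1}^M W_{x_i},\,W_p\Big),$$ where $M$ is an integer and the minimum is $+\infty$ if $L<1$. For $0\le\epsilon<2$ define $$S(\epsilon|\mathbf W)=\inf\{R\in\mathbb R\mid\limsup_{n\to\infty}\epsilon(e^{nR},W^n)\le\epsilon\},\qquad S^\dagger(\epsilon|\mathbf W)=\inf\{R\in\mathbb R\mid\liminf_{n\to\infty}\epsilon(e^{nR},W^n)\le\epsilon\};$$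 for $\epsilon=2$ replace "$\le\epsilon$" by "$<2$". For a sequence $\mathbf p=\{p^n\}$ of distributions $p^n$ on $\mathcal X^n$, $0\le\epsilon<1$ and $a\in\mathbb R$, put $T_n(a)=\sum_x p^n(x)\,W^n_x\{y:\frac1n\log\frac{W^n_x(y)}{W^n_{p^n}(y)}>a\}$ and $$\overline I(\epsilon|\mathbf p,\mathbf W)=\inf\{a\in\mathbb R\mid\limsup_{n\to\infty}T_n(a)\le\epsilon\},\qquad \underline I(\epsilon|\mathbf p,\mathbf W)=\inf\{a\in\mathbb R\mid\liminf_{n\to\infty}T_n(a)\le\epsilon\};$$ for $\epsilon=1$ replace "$\le\epsilon$" by "$<1$". **Theorem.** For every real $0\le\epsilon<1$, $$\sup_{\mathbf p}\underline I(\epsilon|\mathbf p,\mathbf W)\le D(1-\epsilon,0|\mathbf W)\le S^\dagger(\epsilon|\mathbf W)\le\sup_{\mathbf p}\underline I(\tfrac\epsilon2|\mathbf p,\mathbf W),$$ $$\sup_{\mathbf p}\overline I(\epsilon|\mathbf p,\mathbf W)\le D^\dagger(1-\epsilon,0|\mathbf W)\le S(\epsilon|\mathbf W)\le\sup_{\mathbf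 p}\overline I(\tfrac\epsilon2|\mathbf p,\mathbf W).$$ Moreover, the first inequality of each chain holds for all $0\le\epsilon\le1$, and the third inequality of each chain holds for all $0\le\epsilon\le2$. In particular, $$\sup_{\mathbf p}\underline I(0|\mathbf p,\mathbf W)=D(1,0|\mathbf W)=S^\dagger(0|\mathbf W),\qquad \sup_{\mathbf p}\overline I(0|\mathbf p,\mathbf W)=D^\dagger(1,0|\mathbf W)=S(0|\mathbf W).$$ -/

import Mathlib

open Filter
open scoped ENNReal

noncomputable section

namespace IdRes

universe u v

/-- A channel from `X` to `Y`: for every input `x` an output distribution `W x`. -/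
abbrev Channel (X : Type u) (Y : Type v) := X → PMF Y

/-- The output distribution `W_p(y) = ∑ x, p x * W x y` of the input distribution `p`. -/
abbrev output {X : Type u} {Y : Type v} (W : Channel X Y) (p : PMF X) : PMF Y :=
  p.bind W

/-- An identification code: `size` messages, an input distribution for each message and a
decoding region (not necessarily disjoint from the others) for each message. -/
structure IdCode (X : Type u) (Y : Type v) where
  size : ℕ
  size_pos : 0 < size
  enc : Fin size → PMF X
  dec : Fin size → Set Y

namespace IdCode

variable {X : Type u} {Y : Type v}

/-- First error probability: `max_i W_{Q_i}(D_iᶜ)`. -/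
def errFirst (Φ : IdCode X Y) (W : Channel X Y) : ℝ≥0∞ :=
  ⨆ i : Fin Φ.size, (output W (Φ.enc i)).toOuterMeasure (Φ.dec i)ᶜ

/-- Second error probability: `max_{i ≠ j} W_{Q_j}(D_i)` (zero for a single message). -/
def errSecond (Φ : IdCode X Y) (W : Channel X Y) : ℝ≥0∞ :=
  ⨆ (i : Fin Φ.size) (j : Fin Φ.size) (_ : i ≠ j), (output W (Φ.enc j)).toOuterMeasure (Φ.dec i)

/-- `log log |Φ|`, where a code with a single message gets the value zero. -/
def logLogSize (Φ : IdCode X Y) : ℝ :=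
  if Φ.size = 1 then 0 else Real.log (Real.log (Φ.size : ℝ))

end IdCode

/-- The variational distance `∑ y, |f y - g y|` of two (probability) mass functions. -/
def varDist {Y : Type v} (f g : Y → ℝ≥0∞) : ℝ≥0∞ :=
  ∑' y, ENNReal.ofReal |(f y).toReal - (g y).toReal|

/-- A resolvability code: a positive integer `size` and that many inputs. -/
structure ResCode (X : Type u) where
  size : ℕ
  size_pos : 0 < size
  pts : Fin size → X

/-- The output mass function `∑ i, (1 / M) W_{x_i}` of a resolvability code. -/
def ResCode.out {X : Type u} {Y : Type v} (Ψ : ResCode X) (W : Channel X Y) (y : Y) : ℝ≥0∞ :=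
  ∑ i : Fin Ψ.size, (Ψ.size : ℝ≥0∞)⁻¹ * W (Ψ.pts i) y

/-- Worst-case resolvability error `max_p min_{|Ψ| ≤ L} d(Ψ, W_p)` for a real size bound `L`.
The minimum over no codes (`L < 1`) is infinite. -/
def resErr {X : Type u} {Y : Type v} (L : ℝ) (W : Channel X Y) : ℝ≥0∞ :=
  ⨆ p : PMF X, ⨅ (Ψ : ResCode X) (_ : (Ψ.size : ℝ) ≤ L), varDist (Ψ.out W) (output W p)

/-- The probability `E_p W_x {y | (1 / n) log (W_x(y) / W_p(y)) > a}`. -/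
def specTail {X : Type u} {Y : Type v} (n : ℕ) (p : PMF X) (W : Channel X Y) (a : ℝ) : ℝ≥0∞ :=
  ∑' x, p x * (W x).toOuterMeasure
    {y | a < 1 / (n : ℝ) * Real.log ((W x y).toReal / (output W p y).toReal)}

variable {X : ℕ → Type u} {Y : ℕ → Type v}

/-- The `(μ, lam)`-identification capacity `D(μ, lam | W)` (limsup of the first error). -/
def idCap (μ lam : ℝ) (W : ∀ n, Channel (X n) (Y n)) : EReal :=
  ⨆ (Φ : ∀ n, IdCode (X n) (Y n))
    (_ : if μ = 0 then limsup (fun n => (Φ n).errFirst (W n)) atTop = 0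
      else limsup (fun n => (Φ n).errFirst (W n)) atTop < ENNReal.ofReal μ)
    (_ : limsup (fun n => (Φ n).errSecond (W n)) atTop ≤ ENNReal.ofReal lam),
    liminf (fun n : ℕ => ((1 / (n : ℝ) * (Φ n).logLogSize : ℝ) : EReal)) atTop

/-- The `(μ, lam)`-identification capacity `D†(μ, lam | W)` (liminf of the first error). -/
def idCapDagger (μ lam : ℝ) (W : ∀ n, Channel (X n) (Y n)) : EReal :=
  ⨆ (Φ : ∀ n, IdCode (X n) (Y n))
    (_ : if μ = 0 then liminf (fun n => (Φ n).errFirst (W n)) atTop = 0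
      else liminf (fun n => (Φ n).errFirst (W n)) atTop < ENNReal.ofReal μ)
    (_ : limsup (fun n => (Φ n).errSecond (W n)) atTop ≤ ENNReal.ofReal lam),
    liminf (fun n : ℕ => ((1 / (n : ℝ) * (Φ n).logLogSize : ℝ) : EReal)) atTop

/-- The `ε`-resolvability capacity `S(ε | W)` (limsup of the error). -/
def resCap (ε : ℝ) (W : ∀ n, Channel (X n) (Y n)) : EReal :=
  ⨅ (R : ℝ)
    (_ : if ε = 2 then limsup (fun n : ℕ => resErr (Real.exp (n * R)) (W n)) atTop < 2
      else limsup (fun n : ℕ => resErr (Real.exp (n * R)) (W n)) atTop ≤ ENNReal.ofReal ε),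
    (R : EReal)

/-- The `ε`-resolvability capacity `S†(ε | W)` (liminf of the error). -/
def resCapDagger (ε : ℝ) (W : ∀ n, Channel (X n) (Y n)) : EReal :=
  ⨅ (R : ℝ)
    (_ : if ε = 2 then liminf (fun n : ℕ => resErr (Real.exp (n * R)) (W n)) atTop < 2
      else liminf (fun n : ℕ => resErr (Real.exp (n * R)) (W n)) atTop ≤ ENNReal.ofReal ε),
    (R : EReal)

/-- The spectral quantity `Ī(ε | p, W)` (limsup version). -/
def specSup (ε : ℝ) (p : ∀ n, PMF (X n)) (W : ∀ n, Channel (X n) (Y n)) : EReal :=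
  ⨅ (a : ℝ)
    (_ : if ε = 1 then limsup (fun n => specTail n (p n) (W n) a) atTop < 1
      else limsup (fun n => specTail n (p n) (W n) a) atTop ≤ ENNReal.ofReal ε),
    (a : EReal)

/-- The spectral quantity `I̲(ε | p, W)` (liminf version). -/
def specInf (ε : ℝ) (p : ∀ n, PMF (X n)) (W : ∀ n, Channel (X n) (Y n)) : EReal :=
  ⨅ (a : ℝ)
    (_ : if ε = 1 then liminf (fun n => specTail n (p n) (W n) a) atTop < 1
      else liminf (fun n => specTail n (p n) (W n) a) atTop ≤ ENNReal.ofReal ε),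
    (a : EReal)

end IdRes

end

/-! Everything is governed by the tail T(K) of the likelihood ratio W_x(y)/W_p(y), through three
one-shot bounds.

Direct part (`exists_idCode`): each message gets a random M-tuple drawn from p, is encoded uniformly
on it, and is decoded by the union of the sets where the ratio exceeds K. By Markov's inequality
this union has W_p-probability at most M/K. So when M is well below K, the first error exceeds 1 -
T(K) by little and the second is small. The failure probabilities are exponentially small in M, so a
union bound allows exponentially many messages in M: log log N is about log M.

Converse (`size_le_of_resErr_lt`): approximate the output of each message by a resolvability code of
size at most L. One approximation shifts the probability of an event by at most half the variational
distance; comparing two messages uses two of them, so a shared approximation contradicts small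
errors. Counting resolvability codes bounds log log N by log L up to a logarithm in n. This pairs
first error below 1 - ε with resolvability error ε.

Soft covering (`iInf_varDist_le`): M samples from p approximate W_p within 2 T(K) + √(K/M); the
factor 2 turns ε into ε/2.

With K = e^{na} the bounds become limits. First error behaves like 1 - T, which swaps limsup and
liminf; the converse needs good blocklengths only infinitely often, so in either chain one of the
two errors may be controlled by a liminf. -/

noncomputable section

namespace IdRes

/-! ### Expectations and concentration for independent samples -/

section ProductExpectation

variable {α : Type*} [Fintype α]

/-- The expectation of `F` over `M` independent samples with common weights `w`. -/
def prodExp (w : α → ℝ) {M : ℕ} (F : (Fin M → α) → ℝ) : ℝ :=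
  ∑ u : Fin M → α, (∏ k, w (u k)) * F u

lemma prodExp_succ (w : α → ℝ) {M : ℕ} (F : (Fin (M + 1) → α) → ℝ) :
    prodExp w F = ∑ x, w x * prodExp w fun u => F (Fin.cons x u) := by
  unfold prodExp
  rw [← (Fin.consEquiv fun _ => α).sum_comp, Fintype.sum_prod_type]
  refine Finset.sum_congr rfl fun x _ => ?_
  rw [Finset.mul_sum]
  refine Finset.sum_congr rfl fun u _ => ?_
  simp [Fin.consEquiv, Fin.prod_univ_succ, mul_assoc]

lemma prodExp_add (w : α → ℝ) {M : ℕ} (F G : (Fin M → α) → ℝ) :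
    prodExp w (fun u => F u + G u) = prodExp w F + prodExp w G := by
  simp [prodExp, mul_add, Finset.sum_add_distrib]

lemma prodExp_const_mul (w : α → ℝ) {M : ℕ} (c : ℝ) (F : (Fin M → α) → ℝ) :
    prodExp w (fun u => c * F u) = c * prodExp w F := by
  simp only [prodExp, Finset.mul_sum]
  exact Finset.sum_congr rfl fun u _ => by ring

lemma prodExp_sum (w : α → ℝ) {M : ℕ} {ι : Type*} (s : Finset ι) (F : ι → (Fin M → α) → ℝ) :
    prodExp w (fun u => ∑ i ∈ s, F i u) = ∑ i ∈ s, prodExp w (F i) := by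
  simp only [prodExp, Finset.mul_sum]
  exact Finset.sum_comm

lemma prodExp_mono {w : α → ℝ} (hw : ∀ x, 0 ≤ w x) {M : ℕ} {F G : (Fin M → α) → ℝ}
    (h : ∀ u, F u ≤ G u) : prodExp w F ≤ prodExp w G :=
  Finset.sum_le_sum fun u _ =>
    mul_le_mul_of_nonneg_left (h u) (Finset.prod_nonneg fun _ _ => hw _)

lemma prodExp_prod (w : α → ℝ) (M : ℕ) (g : α → ℝ) :
    prodExp w (fun u : Fin M → α => ∏ k, g (u k)) = (∑ x, w x * g x) ^ M := by
  induction M with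
  | zero => simp [prodExp]
  | succ M ih =>
    rw [prodExp_succ]
    simp only [Fin.prod_univ_succ, Fin.cons_zero, Fin.cons_succ, prodExp_const_mul, ih]
    rw [pow_succ', Finset.sum_mul]
    exact Finset.sum_congr rfl fun x _ => by ring

lemma prodExp_const {w : α → ℝ} (hw : ∑ x, w x = 1) (M : ℕ) (c : ℝ) :
    prodExp w (fun _ : Fin M → α => c) = c := by
  have h := prodExp_prod w M fun _ => 1
  simp only [Finset.prod_const_one, mul_one, hw, one_pow] at h
  simpa [h] using prodExp_const_mul (M := M) w c fun _ => 1

lemma prodExp_eval {w : α → ℝ} (hw : ∑ x, w x = 1) {M : ℕ} (i : Fin M) (f : α → ℝ) :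
    prodExp w (fun u => f (u i)) = ∑ x, w x * f x := by
  induction M with
  | zero => exact i.elim0
  | succ M ih =>
    rw [prodExp_succ]
    refine Fin.cases ?_ (fun j => ?_) i
    · simp [prodExp_const hw]
    · simp only [Fin.cons_succ, ih j, ← Finset.sum_mul, hw, one_mul]

lemma prodExp_eval_pair {w : α → ℝ} (hw : ∑ x, w x = 1) {M : ℕ} {i j : Fin M} (hij : i ≠ j)
    (F : α → α → ℝ) :
    prodExp w (fun u => F (u i) (u j)) = ∑ x, w x * ∑ y, w y * F x y := by
  induction M with
  | zero => exact i.elim0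
  | succ M ih =>
    rw [prodExp_succ]
    induction i using Fin.cases with
    | zero =>
      induction j using Fin.cases with
      | zero => exact absurd rfl hij
      | succ j =>
        simp only [Fin.cons_zero, Fin.cons_succ]
        exact Finset.sum_congr rfl fun x _ => by rw [prodExp_eval hw j]
    | succ i =>
      induction j using Fin.cases with
      | zero =>
        simp only [Fin.cons_zero, Fin.cons_succ]
        simp only [Finset.mul_sum]
        rw [Finset.sum_comm]
        refine Finset.sum_congr rfl fun x _ => ?_
        rw [prodExp_eval hw i fun y => F y x, Finset.mul_sum]
        exact Finset.sum_congr rfl fun y _ => by ring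
      | succ j =>
        have hij' : i ≠ j := fun h => hij (by rw [h])
        simp only [Fin.cons_succ, ih hij', ← Finset.sum_mul, hw, one_mul]

lemma prodExp_sum_eval {w : α → ℝ} (hw : ∑ x, w x = 1) (M : ℕ) (f : α → ℝ) :
    prodExp w (fun u : Fin M → α => ∑ k, f (u k)) = M * ∑ x, w x * f x := by
  rw [prodExp_sum]
  simp [prodExp_eval hw]

lemma prodExp_sum_sq {w : α → ℝ} (hw : ∑ x, w x = 1) (M : ℕ) {f : α → ℝ}
    (hf : ∑ x, w x * f x = 0) :
    prodExp w (fun u : Fin M → α => (∑ k, f (u k)) ^ 2) = M * ∑ x, w x * f x ^ 2 := by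
  induction M with
  | zero => simp [prodExp]
  | succ M ih =>
    rw [prodExp_succ]
    have h (x : α) : prodExp w (fun u : Fin M → α =>
        (∑ k, f ((Fin.cons x u : Fin (M + 1) → α) k)) ^ 2) =
        f x ^ 2 + M * ∑ y, w y * f y ^ 2 := by
      simp only [Fin.sum_univ_succ, Fin.cons_zero, Fin.cons_succ, add_sq]
      rw [prodExp_add, prodExp_add, prodExp_const hw, prodExp_const_mul, prodExp_sum_eval hw, hf,
        ih]
      ring
    simp only [h, mul_add, Finset.sum_add_distrib, ← Finset.sum_mul, hw]
    push_cast
    ring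

/-- The variance of |F| is nonnegative. -/
lemma prodExp_abs_le_sqrt {w : α → ℝ} (hw0 : ∀ x, 0 ≤ w x) (hw : ∑ x, w x = 1) {M : ℕ}
    (F : (Fin M → α) → ℝ) :
    prodExp w (fun u => |F u|) ≤ √(prodExp w fun u => F u ^ 2) := by
  refine Real.le_sqrt_of_sq_le ?_
  set m := prodExp w fun u => |F u|
  have h : 0 ≤ prodExp w fun u => (|F u| - m) ^ 2 :=
    Finset.sum_nonneg fun u _ => mul_nonneg (Finset.prod_nonneg fun _ _ => hw0 _) (sq_nonneg _)
  have h2 : (fun u => (|F u| - m) ^ 2) = fun u => (F u ^ 2 + (-2 * m) * |F u|) + m ^ 2 := by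
    ext u
    rw [sub_sq, sq_abs]
    ring
  rw [h2, prodExp_add, prodExp_add, prodExp_const_mul, prodExp_const hw] at h
  change 0 ≤ _ + -2 * m * m + m ^ 2 at h
  linarith

/-- Mean deviation of an empirical average, where only the part `b` of `b + c` is controlled. -/
lemma prodExp_abs_average_sub_le {w : α → ℝ} (hw0 : ∀ x, 0 ≤ w x) (hw : ∑ x, w x = 1) {M : ℕ}
    (hM : 0 < M) {b c : α → ℝ} (hb : ∀ x, 0 ≤ b x) (hc : ∀ x, 0 ≤ c x) {K q : ℝ} (hK : 0 ≤ K)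
    (hq : q = ∑ x, w x * (b x + c x)) (hbK : ∀ x, b x ≤ K * q) :
    prodExp w (fun u : Fin M → α => |(M : ℝ)⁻¹ * ∑ k, (b (u k) + c (u k)) - q|) ≤
      2 * ∑ x, w x * c x + q * √(K / M) := by
  have hM' : (0 : ℝ) < M := by exact_mod_cast hM
  set B := ∑ x, w x * b x
  set C := ∑ x, w x * c x
  have hqBC : q = B + C := by rw [hq]; simp [B, C, mul_add, Finset.sum_add_distrib]
  have hC : 0 ≤ C := Finset.sum_nonneg fun x _ => mul_nonneg (hw0 x) (hc x)
  have hB : 0 ≤ B := Finset.sum_nonneg fun x _ => mul_nonneg (hw0 x) (hb x)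
  have hq0 : 0 ≤ q := by linarith
  have hpt (u : Fin M → α) : |(M : ℝ)⁻¹ * ∑ k, (b (u k) + c (u k)) - q| ≤
      (M : ℝ)⁻¹ * |∑ k, (b (u k) - B)| + ((M : ℝ)⁻¹ * ∑ k, c (u k) + C) := by
    have h1 : (M : ℝ)⁻¹ * ∑ k, (b (u k) + c (u k)) - q =
        (M : ℝ)⁻¹ * ∑ k, (b (u k) - B) + ((M : ℝ)⁻¹ * ∑ k, c (u k) + -C) := by
      rw [hqBC, Finset.sum_add_distrib, Finset.sum_sub_distrib]
      simp only [Finset.sum_const, Finset.card_univ, Fintype.card_fin, nsmul_eq_mul]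
      field_simp
      ring
    have h2 : 0 ≤ (M : ℝ)⁻¹ * ∑ k, c (u k) :=
      mul_nonneg (inv_nonneg.2 hM'.le) (Finset.sum_nonneg fun k _ => hc _)
    rw [h1]
    refine (abs_add_le _ _).trans (add_le_add ?_ ((abs_add_le _ _).trans ?_))
    · rw [abs_mul, abs_of_pos (inv_pos.2 hM')]
    · rw [abs_of_nonneg h2, abs_neg, abs_of_nonneg hC]
  refine (prodExp_mono hw0 hpt).trans ?_
  rw [prodExp_add, prodExp_add, prodExp_const_mul, prodExp_const_mul, prodExp_const hw,
    prodExp_sum_eval hw]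
  have hcen : ∑ x, w x * (b x - B) = 0 := by
    simp only [mul_sub, Finset.sum_sub_distrib, ← Finset.sum_mul, hw]
    simp [B]
  -- The variance is at most the second moment; one factor b is bounded by K q, the other averages
  -- to B ≤ q.
  have hvar : ∑ x, w x * (b x - B) ^ 2 ≤ K * q ^ 2 := by
    have h1 : ∑ x, w x * (b x - B) ^ 2 = ∑ x, w x * b x ^ 2 - B ^ 2 := by
      have : ∀ x, w x * (b x - B) ^ 2 = w x * b x ^ 2 - 2 * B * (w x * b x) + w x * B ^ 2 :=
        fun x => by ring
      simp only [this, Finset.sum_add_distrib, Finset.sum_sub_distrib, ← Finset.mul_sum,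
        ← Finset.sum_mul, hw]
      change _ - 2 * B * B + 1 * B ^ 2 = _
      ring
    have h2 : ∑ x, w x * b x ^ 2 ≤ ∑ x, w x * b x * (K * q) :=
      Finset.sum_le_sum fun x _ => by
        rw [sq, ← mul_assoc]
        exact mul_le_mul_of_nonneg_left (hbK x) (mul_nonneg (hw0 x) (hb x))
    rw [← Finset.sum_mul] at h2
    have h3 : B * (K * q) ≤ q * (K * q) :=
      mul_le_mul_of_nonneg_right (by linarith) (mul_nonneg hK hq0)
    nlinarith [sq_nonneg B]
  have hdev : (M : ℝ)⁻¹ * prodExp w (fun u : Fin M → α => |∑ k, (b (u k) - B)|) ≤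
      q * √(K / M) := by
    have h := prodExp_abs_le_sqrt hw0 hw fun u : Fin M → α => ∑ k, (b (u k) - B)
    rw [prodExp_sum_sq hw M (f := fun x => b x - B) hcen] at h
    have h2 : √((M : ℝ) * ∑ x, w x * (b x - B) ^ 2) ≤ M * (q * √(K / M)) := by
      refine Real.sqrt_le_iff.2 ⟨by positivity, ?_⟩
      rw [mul_pow, mul_pow, Real.sq_sqrt (by positivity)]
      calc (M : ℝ) * ∑ x, w x * (b x - B) ^ 2 ≤ M * (K * q ^ 2) := by gcongr
        _ = _ := by field_simp
    calc _ ≤ (M : ℝ)⁻¹ * (M * (q * √(K / M))) := by gcongr; exact h.trans h2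
      _ = _ := by field_simp
  have hMC : (M : ℝ)⁻¹ * (M * C) = C := by field_simp
  change _ + ((M : ℝ)⁻¹ * (M * C) + C) ≤ _
  linarith

/-- Chernoff bound for the product weight of an event. -/
lemma prodExp_indicator_le {w : α → ℝ} (hw0 : ∀ x, 0 ≤ w x) {M : ℕ} (f : α → ℝ) (s θ : ℝ)
    {A : Set (Fin M → α)} (hA : ∀ u ∈ A, θ ≤ s * ∑ k, f (u k)) :
    prodExp w (A.indicator 1) ≤
      Real.exp (-θ) * (∑ x, w x * Real.exp (s * f x)) ^ M := by
  rw [← prodExp_prod, ← prodExp_const_mul]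
  refine prodExp_mono hw0 fun u => ?_
  rw [← Real.exp_sum, ← Real.exp_add]
  by_cases hu : u ∈ A
  · rw [Set.indicator_of_mem hu, Pi.one_apply]
    refine Real.one_le_exp ?_
    have := hA u hu
    rw [Finset.mul_sum] at this
    linarith
  · rw [Set.indicator_of_notMem hu]
    positivity

/-- On [0, 1] the convex function exp(s ·) lies below its chord; then 1 + z ≤ e^z. -/
lemma sum_mul_exp_le {w : α → ℝ} (hw0 : ∀ x, 0 ≤ w x) (hw : ∑ x, w x = 1) {f : α → ℝ}
    (hf0 : ∀ x, 0 ≤ f x) (hf1 : ∀ x, f x ≤ 1) (s : ℝ) :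
    ∑ x, w x * Real.exp (s * f x) ≤ Real.exp ((Real.exp s - 1) * ∑ x, w x * f x) := by
  have h1 (x : α) : Real.exp (s * f x) ≤ 1 + (Real.exp s - 1) * f x := by
    have := convexOn_exp.2 (Set.mem_univ s) (Set.mem_univ (0 : ℝ)) (hf0 x)
      (sub_nonneg.2 (hf1 x)) (by ring)
    simp only [smul_eq_mul, mul_zero, add_zero, Real.exp_zero, mul_one] at this
    rw [mul_comm s]
    linarith
  calc _ ≤ ∑ x, w x * (1 + (Real.exp s - 1) * f x) :=
        Finset.sum_le_sum fun x _ => mul_le_mul_of_nonneg_left (h1 x) (hw0 x)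
    _ = (Real.exp s - 1) * ∑ x, w x * f x + 1 := by
        simp only [mul_add, Finset.sum_add_distrib, mul_one, hw, Finset.mul_sum]
        rw [add_comm]
        congr 1
        exact Finset.sum_congr rfl fun x _ => by ring
    _ ≤ _ := Real.add_one_le_exp _

/-- Upper tail: an average of samples with a small mean rarely exceeds `t`. -/
lemma prodExp_indicator_upper {w : α → ℝ} (hw0 : ∀ x, 0 ≤ w x) (hw : ∑ x, w x = 1) {M : ℕ}
    {f : α → ℝ} (hf0 : ∀ x, 0 ≤ f x) (hf1 : ∀ x, f x ≤ 1) {t : ℝ}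
    (hm : 4 * ∑ x, w x * f x ≤ t) :
    prodExp w ({u : Fin M → α | M * t < ∑ k, f (u k)}.indicator 1) ≤
      Real.exp (-(M * (t / 2))) := by
  have hm0 : 0 ≤ ∑ x, w x * f x := Finset.sum_nonneg fun x _ => mul_nonneg (hw0 x) (hf0 x)
  refine (prodExp_indicator_le hw0 f 1 (M * t) fun u hu => ?_).trans ?_
  · rw [one_mul]; exact le_of_lt hu
  calc _ ≤ Real.exp (-(M * t)) * Real.exp ((Real.exp 1 - 1) * ∑ x, w x * f x) ^ M := by
        gcongr
        · exact Finset.sum_nonneg fun x _ => mul_nonneg (hw0 x) (Real.exp_pos _).le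
        · exact sum_mul_exp_le hw0 hw hf0 hf1 1
    _ = Real.exp (M * ((Real.exp 1 - 1) * ∑ x, w x * f x - t)) := by
        rw [← Real.exp_nat_mul, ← Real.exp_add]
        congr 1
        ring
    _ ≤ _ := by
        rw [← mul_neg]
        have := Real.exp_one_lt_d9
        -- With e - 1 ≤ 2 and mean at most t/4, the exponent is at most M (t/2 - t).
        have : (Real.exp 1 - 1) * ∑ x, w x * f x ≤ 2 * ∑ x, w x * f x := by gcongr; linarith
        gcongr
        linarith

/-- Lower tail: an average of samples is rarely below the mean by `t`. -/
lemma prodExp_indicator_lower {w : α → ℝ} (hw0 : ∀ x, 0 ≤ w x) (hw : ∑ x, w x = 1) {M : ℕ}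
    {f : α → ℝ} (hf0 : ∀ x, 0 ≤ f x) (hf1 : ∀ x, f x ≤ 1) {t : ℝ} (ht0 : 0 ≤ t) (ht1 : t ≤ 1) :
    prodExp w ({u : Fin M → α | ∑ k, f (u k) < M * (∑ x, w x * f x - t)}.indicator 1) ≤
      Real.exp (-(M * (t ^ 2 / 2))) := by
  set m := ∑ x, w x * f x
  have hm0 : 0 ≤ m := Finset.sum_nonneg fun x _ => mul_nonneg (hw0 x) (hf0 x)
  have hm1 : m ≤ 1 := by
    rw [← hw]
    exact Finset.sum_le_sum fun x _ => mul_le_of_le_one_right (hw0 x) (hf1 x)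
  refine (prodExp_indicator_le hw0 f (-t) (-t * (M * (m - t))) fun u hu => ?_).trans ?_
  · exact mul_le_mul_of_nonpos_left (le_of_lt hu) (by linarith)
  calc _ ≤ Real.exp (-(-t * (M * (m - t)))) * Real.exp ((Real.exp (-t) - 1) * m) ^ M := by
        gcongr
        · exact Finset.sum_nonneg fun x _ => mul_nonneg (hw0 x) (Real.exp_pos _).le
        · exact sum_mul_exp_le hw0 hw hf0 hf1 (-t)
    _ = Real.exp (M * (t * (m - t) + (Real.exp (-t) - 1) * m)) := by
        rw [← Real.exp_nat_mul, ← Real.exp_add]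
        congr 1
        ring
    _ ≤ _ := by
        rw [← mul_neg]
        -- Here (1 + t + t²/2)(1 - t + t²/2) = 1 + t⁴/4 ≥ 1.
        have h1 : Real.exp (-t) ≤ 1 - t + t ^ 2 / 2 := by
          have := Real.quadratic_le_exp_of_nonneg ht0
          rw [Real.exp_neg, inv_le_comm₀ (Real.exp_pos _) (by nlinarith)]
          refine le_trans ?_ this
          rw [inv_le_iff_one_le_mul₀ (by nlinarith)]
          nlinarith [sq_nonneg t, sq_nonneg (t ^ 2)]
        have h2 : (Real.exp (-t) - 1) * m ≤ (-t + t ^ 2 / 2) * m := by gcongr; linarith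
        gcongr
        nlinarith [sq_nonneg t]

/-- Union bound: samples avoiding a rare event and, pairwise, a rare relation. -/
lemma exists_forall_notMem_and_pairwise {w : α → ℝ} (hw0 : ∀ x, 0 ≤ w x) (hw : ∑ x, w x = 1)
    {N : ℕ} {η : ℝ} (hη : (N : ℝ) ^ 2 * η < 1) (A : Set α) (B : α → Set α)
    (hA : ∑ x, w x * A.indicator 1 x ≤ η) (hB : ∀ x, ∑ y, w y * (B x).indicator 1 y ≤ η) :
    ∃ u : Fin N → α, (∀ i, u i ∉ A) ∧ ∀ i j, i ≠ j → u j ∉ B (u i) := by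
  classical
  -- Diagonal terms record the event `A`, off-diagonal ones the relation `B`: N² indicators, each of
  -- mean at most η.
  let F (i j : Fin N) (u : Fin N → α) : ℝ :=
    if i = j then A.indicator 1 (u i) else (B (u i)).indicator 1 (u j)
  have hF0 i j u : 0 ≤ F i j u := by
    dsimp only [F]
    split_ifs <;> exact Set.indicator_nonneg (fun _ _ => zero_le_one) _
  have hF (i j) : prodExp w (F i j) ≤ η := by
    by_cases h : i = j
    · simp only [F, h, if_true]
      rwa [prodExp_eval hw j]
    · simp only [F, h, if_false]
      rw [prodExp_eval_pair hw h fun x y => (B x).indicator 1 y]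
      calc _ ≤ ∑ x, w x * η :=
            Finset.sum_le_sum fun x _ => mul_le_mul_of_nonneg_left (hB x) (hw0 x)
        _ = η := by rw [← Finset.sum_mul, hw, one_mul]
  have hsum : prodExp w (fun u => ∑ i, ∑ j, F i j u) < 1 := by
    rw [prodExp_sum]
    refine lt_of_le_of_lt ?_ hη
    calc _ = ∑ i, ∑ j, prodExp w (F i j) := Finset.sum_congr rfl fun i _ => prodExp_sum ..
      _ ≤ ∑ _i : Fin N, ∑ _j : Fin N, η :=
        Finset.sum_le_sum fun i _ => Finset.sum_le_sum fun j _ => hF i j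
      _ = _ := by simp; ring
  obtain ⟨u, hu⟩ : ∃ u : Fin N → α, ∑ i, ∑ j, F i j u < 1 := by
    by_contra! h
    have := prodExp_mono hw0 h
    rw [prodExp_const hw] at this
    linarith
  have hlt (i j) : F i j u < 1 :=
    lt_of_le_of_lt ((Finset.single_le_sum (fun j _ => hF0 i j u) (Finset.mem_univ j)).trans
      (Finset.single_le_sum (f := fun i => ∑ j, F i j u)
        (fun i _ => Finset.sum_nonneg fun j _ => hF0 i j u) (Finset.mem_univ i))) hu
  refine ⟨u, fun i hi => ?_, fun i j hij hj => ?_⟩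
  · have := hlt i i
    simp [F, hi] at this
  · have := hlt i j
    simp [F, hij, hj] at this

end ProductExpectation

/-! ### Likelihood ratio tails and one-shot soft covering -/

section OneShot

variable {X : Type*} {Y : Type*}

lemma toOuterMeasure_add_compl (P : PMF Y) (s : Set Y) :
    P.toOuterMeasure s + P.toOuterMeasure sᶜ = 1 := by
  rw [PMF.toOuterMeasure_apply, PMF.toOuterMeasure_apply, ← ENNReal.tsum_add, ← P.tsum_coe]
  exact tsum_congr fun y => Set.indicator_self_add_compl_apply s P y

lemma toOuterMeasure_le_one (P : PMF Y) (s : Set Y) : P.toOuterMeasure s ≤ 1 :=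
  (toOuterMeasure_add_compl P s).symm ▸ le_self_add

lemma toOuterMeasure_ne_top (P : PMF Y) (s : Set Y) : P.toOuterMeasure s ≠ ∞ :=
  ne_top_of_le_ne_top ENNReal.one_ne_top (toOuterMeasure_le_one P s)

lemma toReal_toOuterMeasure_le_one (P : PMF Y) (s : Set Y) : (P.toOuterMeasure s).toReal ≤ 1 :=
  ENNReal.toReal_le_of_le_ofReal zero_le_one (by simpa using toOuterMeasure_le_one P s)

lemma toOuterMeasure_compl (P : PMF Y) (s : Set Y) :
    P.toOuterMeasure sᶜ = 1 - P.toOuterMeasure s :=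
  ENNReal.eq_sub_of_add_eq' ENNReal.one_ne_top
    (by rw [add_comm]; exact toOuterMeasure_add_compl P s)

/-- The outputs at which the likelihood ratio `W_x(y) / W_p(y)` exceeds `K`. -/
def ratioSet (K : ℝ) (p : PMF X) (W : Channel X Y) (x : X) : Set Y :=
  {y | ENNReal.ofReal K * output W p y < W x y}

/-- Markov's inequality for the likelihood ratio. -/
lemma mul_toOuterMeasure_ratioSet_le_one (K : ℝ) (p : PMF X) (W : Channel X Y) (x : X) :
    ENNReal.ofReal K * (output W p).toOuterMeasure (ratioSet K p W x) ≤ 1 := by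
  rw [PMF.toOuterMeasure_apply, ← ENNReal.tsum_mul_left, ← (W x).tsum_coe]
  refine ENNReal.tsum_le_tsum fun y => ?_
  by_cases hy : y ∈ ratioSet K p W x
  · rw [Set.indicator_of_mem hy]
    exact le_of_lt hy
  · simp [Set.indicator_of_notMem hy]

variable [Fintype X]

lemma sum_toReal (p : PMF X) : ∑ x, (p x).toReal = 1 := by
  rw [← ENNReal.toReal_sum fun x _ => p.apply_ne_top x, ← tsum_fintype (L := .unconditional X),
    p.tsum_coe, ENNReal.toReal_one]

lemma toReal_output (W : Channel X Y) (p : PMF X) (y : Y) :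
    (output W p y).toReal = ∑ x, (p x).toReal * (W x y).toReal := by
  rw [PMF.bind_apply, tsum_fintype, ENNReal.toReal_sum]
  · simp
  · exact fun x _ => ENNReal.mul_ne_top (p.apply_ne_top x) ((W x).apply_ne_top y)

lemma toReal_output_toOuterMeasure (W : Channel X Y) (p : PMF X) (s : Set Y) :
    ((output W p).toOuterMeasure s).toReal =
      ∑ x, (p x).toReal * ((W x).toOuterMeasure s).toReal := by
  rw [PMF.toOuterMeasure_bind_apply, tsum_fintype, ENNReal.toReal_sum]
  · simp
  · exact fun x _ => ENNReal.mul_ne_top (p.apply_ne_top x) (toOuterMeasure_ne_top _ _)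

/-- The probability that the likelihood ratio exceeds `K`. -/
def ratioTail (K : ℝ) (p : PMF X) (W : Channel X Y) : ℝ≥0∞ :=
  ∑ x, p x * (W x).toOuterMeasure (ratioSet K p W x)

/-- The two events can differ only where p(x) or W_x(y) vanishes, through the conventions for
division by zero and log 0, and such points carry no mass. -/
lemma specTail_eq_ratioTail {n : ℕ} (hn : 0 < n) (p : PMF X) (W : Channel X Y) (a : ℝ) :
    specTail n p W a = ratioTail (Real.exp (n * a)) p W := by
  rw [specTail, ratioTail, tsum_fintype]
  refine Finset.sum_congr rfl fun x _ => ?_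
  rcases eq_or_ne (p x) 0 with hx | hx
  · simp [hx]
  congr 1
  apply PMF.toOuterMeasure_apply_eq_of_inter_support_eq
  ext y
  refine and_congr_left fun hy => ?_
  rw [PMF.mem_support_iff] at hy
  have hq : output W p y ≠ 0 := by
    rw [PMF.bind_apply, Ne, ENNReal.tsum_eq_zero]
    exact fun h => mul_ne_zero hx hy (h x)
  have hq' : 0 < (output W p y).toReal := ENNReal.toReal_pos hq (PMF.apply_ne_top _ _)
  have hy' : 0 < (W x y).toReal := ENNReal.toReal_pos hy (PMF.apply_ne_top _ _)
  have hn' : (0 : ℝ) < n := by exact_mod_cast hn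
  rw [ratioSet, Set.mem_ofPred_eq, Set.mem_ofPred_eq, one_div, ← div_eq_inv_mul, lt_div_iff₀ hn',
    Real.lt_log_iff_exp_lt (div_pos hy' hq'), lt_div_iff₀ hq', mul_comm a,
    ← ENNReal.ofReal_toReal (PMF.apply_ne_top (output W p) y),
    ← ENNReal.ofReal_toReal (PMF.apply_ne_top (W x) y), ← ENNReal.ofReal_mul (Real.exp_pos _).le,
    ENNReal.ofReal_lt_ofReal_iff hy', ENNReal.toReal_ofReal hq'.le, ENNReal.toReal_ofReal hy'.le]

lemma ratioTail_le_one (K : ℝ) (p : PMF X) (W : Channel X Y) : ratioTail K p W ≤ 1 := by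
  calc _ ≤ ∑ x, p x :=
        Finset.sum_le_sum fun x _ => mul_le_of_le_one_right' (toOuterMeasure_le_one _ _)
    _ = 1 := by rw [← tsum_fintype (L := .unconditional X), p.tsum_coe]

lemma toReal_ratioTail (K : ℝ) (p : PMF X) (W : Channel X Y) :
    (ratioTail K p W).toReal =
      ∑ x, (p x).toReal * ((W x).toOuterMeasure (ratioSet K p W x)).toReal := by
  rw [ratioTail, ENNReal.toReal_sum]
  · simp
  · exact fun x _ => ENNReal.mul_ne_top (p.apply_ne_top x) (toOuterMeasure_ne_top _ _)

lemma iInf_le_sum_ofReal_prod_mul (p : PMF X) {M : ℕ} (F : (Fin M → X) → ℝ≥0∞) :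
    ⨅ u, F u ≤ ∑ u : Fin M → X, ENNReal.ofReal (∏ k, (p (u k)).toReal) * F u := by
  have h : ∑ u : Fin M → X, ENNReal.ofReal (∏ k, (p (u k)).toReal) = 1 := by
    rw [← ENNReal.ofReal_sum_of_nonneg
      fun u _ => Finset.prod_nonneg fun _ _ => ENNReal.toReal_nonneg]
    have := prodExp_const (sum_toReal p) M 1
    simp only [prodExp, mul_one] at this
    rw [this, ENNReal.ofReal_one]
  calc ⨅ u, F u = ∑ u : Fin M → X, ENNReal.ofReal (∏ k, (p (u k)).toReal) * ⨅ u, F u := by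
        rw [← Finset.sum_mul, h, one_mul]
    _ ≤ _ := Finset.sum_le_sum fun u _ => mul_le_mul_right (iInf_le F u) _

/-- Soft covering: some resolvability code of size `M` approximates the output of `p`. -/
lemma iInf_varDist_le (W : Channel X Y) (p : PMF X) {M : ℕ} (hM : 0 < M) {K : ℝ} (hK : 0 ≤ K) :
    ⨅ u : Fin M → X, varDist (ResCode.out ⟨M, hM, u⟩ W) (output W p) ≤
      2 * ratioTail K p W + ENNReal.ofReal √(K / M) := by
  classical
  refine (iInf_le_sum_ofReal_prod_mul p _).trans ?_
  set w : X → ℝ := fun x => (p x).toReal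
  have hw0 (x) : 0 ≤ w x := ENNReal.toReal_nonneg
  simp only [varDist, ← ENNReal.tsum_mul_left]
  rw [← Summable.tsum_finsetSum fun _ _ => ENNReal.summable]
  -- Truncation at ratio K: `b` is bounded by K W_p(y), so its average concentrates, while the total
  -- mass of `c` is the ratio tail.
  let c (y : Y) (x : X) : ℝ := if y ∈ ratioSet K p W x then (W x y).toReal else 0
  let b (y : Y) (x : X) : ℝ := if y ∈ ratioSet K p W x then 0 else (W x y).toReal
  have hbc y x : b y x + c y x = (W x y).toReal := by
    dsimp only [b, c]
    split_ifs <;> simp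
  have hb y x : 0 ≤ b y x := by
    dsimp only [b]
    split_ifs <;> simp
  have hc y x : 0 ≤ c y x := by
    dsimp only [c]
    split_ifs <;> simp
  have hbK y x : b y x ≤ K * (output W p y).toReal := by
    dsimp only [b]
    split_ifs with h
    · positivity
    · have h' : W x y ≤ ENNReal.ofReal K * output W p y := not_lt.1 h
      have := ENNReal.toReal_mono
        (ENNReal.mul_ne_top ENNReal.ofReal_ne_top (PMF.apply_ne_top _ _)) h'
      rwa [ENNReal.toReal_mul, ENNReal.toReal_ofReal hK] at this
  have hpt (y : Y) : ∑ u : Fin M → X, ENNReal.ofReal (∏ k, w (u k)) *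
      ENNReal.ofReal |(ResCode.out ⟨M, hM, u⟩ W y).toReal - (output W p y).toReal| ≤
      2 * ∑ x, p x * (ratioSet K p W x).indicator (W x) y +
        output W p y * ENNReal.ofReal √(K / M) := by
    have h := prodExp_abs_average_sub_le hw0 (sum_toReal p) hM (hb y) (hc y) hK
      (q := (output W p y).toReal) (by simp only [hbc]; exact toReal_output W p y) (hbK y)
    have hout (u : Fin M → X) : (ResCode.out ⟨M, hM, u⟩ W y).toReal =
        (M : ℝ)⁻¹ * ∑ k, (b y (u k) + c y (u k)) := by
      simp only [hbc, ResCode.out]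
      rw [ENNReal.toReal_sum, Finset.mul_sum]
      · simp
      · exact fun k _ => ENNReal.mul_ne_top (by simp [hM.ne']) (PMF.apply_ne_top _ _)
    simp only [hout, ← ENNReal.ofReal_mul (Finset.prod_nonneg fun _ _ => hw0 _)]
    rw [← ENNReal.ofReal_sum_of_nonneg fun u _ =>
      mul_nonneg (Finset.prod_nonneg fun _ _ => hw0 _) (abs_nonneg _)]
    refine (ENNReal.ofReal_le_ofReal h).trans (ENNReal.ofReal_add_le.trans ?_)
    rw [ENNReal.ofReal_mul ENNReal.toReal_nonneg, ENNReal.ofReal_toReal (PMF.apply_ne_top _ _),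
      ENNReal.ofReal_mul zero_le_two, ENNReal.ofReal_ofNat,
      ENNReal.ofReal_sum_of_nonneg fun x _ => mul_nonneg (hw0 x) (hc y x)]
    refine add_le_add_left (mul_le_mul_right (le_of_eq (Finset.sum_congr rfl fun x _ => ?_)) _) _
    rw [ENNReal.ofReal_mul (hw0 x), ENNReal.ofReal_toReal (p.apply_ne_top x)]
    congr 1
    dsimp only [c]
    by_cases h : y ∈ ratioSet K p W x
    · rw [if_pos h, Set.indicator_of_mem h, ENNReal.ofReal_toReal (PMF.apply_ne_top _ _)]
    · simp [h]
  refine (ENNReal.tsum_le_tsum hpt).trans ?_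
  rw [ENNReal.tsum_add, ENNReal.tsum_mul_right, PMF.tsum_coe, one_mul, ENNReal.tsum_mul_left,
    Summable.tsum_finsetSum fun _ _ => ENNReal.summable]
  simp only [ENNReal.tsum_mul_left, ← PMF.toOuterMeasure_apply]
  exact le_rfl

lemma iInf_resCode_varDist_le (W : Channel X Y) (p : PMF X) {L : ℝ} (hL : 1 ≤ L) {K : ℝ}
    (hK : 0 ≤ K) :
    ⨅ (Ψ : ResCode X) (_ : (Ψ.size : ℝ) ≤ L), varDist (Ψ.out W) (output W p) ≤
      2 * ratioTail K p W + ENNReal.ofReal √(2 * K / L) := by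
  have hM : 0 < ⌊L⌋₊ := Nat.floor_pos.2 hL
  refine le_trans (le_iInf fun u => ?_) ((iInf_varDist_le W p hM hK).trans ?_)
  · exact iInf₂_le (f := fun (Ψ : ResCode X) (_ : (Ψ.size : ℝ) ≤ L) =>
      varDist (Ψ.out W) (output W p)) (ResCode.mk ⌊L⌋₊ hM u)
      (Nat.floor_le (zero_le_one.trans hL))
  -- Rounding L ≥ 1 down loses at most a factor 2.
  · gcongr 2 * _ + ENNReal.ofReal √?_
    have h1 : L < ⌊L⌋₊ + 1 := Nat.lt_floor_add_one L
    have h2 : (1 : ℝ) ≤ ⌊L⌋₊ := by exact_mod_cast hM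
    rw [div_le_div_iff₀ (by linarith) (by linarith)]
    nlinarith

/-- A crude bound, used only for finiteness. -/
lemma resErr_le_four (W : Channel X Y) {L : ℝ} (hL : 1 ≤ L) : resErr L W ≤ 4 := by
  refine iSup_le fun p => (iInf_resCode_varDist_le W p hL zero_le_one).trans ?_
  have h1 : √(2 * 1 / L) ≤ 2 := by
    rw [Real.sqrt_le_left (by norm_num), div_le_iff₀ (by linarith)]
    linarith
  calc _ ≤ 2 * 1 + ENNReal.ofReal 2 := by
        gcongr
        exact ratioTail_le_one ..
    _ = 4 := by norm_num

/-- The worst-case resolvability error is nearly attained at some input distribution, and is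
there controlled by the tail of the likelihood ratio. -/
lemma exists_resErr_le (W : Channel X Y) [Nonempty X] {L : ℝ} (hL : 1 ≤ L) {δ : ℝ≥0∞}
    (hδ : δ ≠ 0) :
    ∃ p : PMF X, ∀ K, 0 ≤ K →
      resErr L W ≤ 2 * ratioTail K p W + ENNReal.ofReal √(2 * K / L) + δ := by
  have hne : Nonempty (PMF X) := ⟨PMF.pure (Classical.arbitrary X)⟩
  obtain ⟨p, hp⟩ : ∃ p : PMF X, resErr L W ≤
      (⨅ (Ψ : ResCode X) (_ : (Ψ.size : ℝ) ≤ L), varDist (Ψ.out W) (output W p)) + δ := by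
    -- If every p fell short by δ, the supremum plus δ would not exceed the finite supremum.
    by_contra! h
    have h1 : resErr L W + δ ≤ resErr L W := by
      conv_lhs => rw [resErr, ENNReal.iSup_add]
      exact iSup_le fun p => (h p).le
    exact absurd h1 (not_le.2 (ENNReal.lt_add_right
      (ne_top_of_le_ne_top (by norm_num) (resErr_le_four W hL)) hδ))
  exact ⟨p, fun K hK => hp.trans (add_le_add_left (iInf_resCode_varDist_le W p hL hK) δ)⟩

end OneShot

/-! ### Empirical input distributions -/

section UniformInput

variable {X : Type*} {Y : Type*}

/-- The empirical distribution of `M` inputs. -/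
def empirical {M : ℕ} (hM : 0 < M) (u : Fin M → X) : PMF X :=
  haveI : Nonempty (Fin M) := ⟨⟨0, hM⟩⟩
  (PMF.uniformOfFintype (Fin M)).map u

lemma output_empirical_apply (W : Channel X Y) {M : ℕ} (hM : 0 < M) (u : Fin M → X) (y : Y) :
    output W (empirical hM u) y = ∑ k, (M : ℝ≥0∞)⁻¹ * W (u k) y := by
  rw [output, empirical, PMF.bind_map, PMF.bind_apply, tsum_fintype]
  simp

lemma toReal_output_empirical (W : Channel X Y) {M : ℕ} (hM : 0 < M) (u : Fin M → X)
    (s : Set Y) :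
    ((output W (empirical hM u)).toOuterMeasure s).toReal =
      (M : ℝ)⁻¹ * ∑ k, ((W (u k)).toOuterMeasure s).toReal := by
  rw [output, empirical, PMF.bind_map, PMF.toOuterMeasure_bind_apply, tsum_fintype,
    ENNReal.toReal_sum, Finset.mul_sum]
  · simp
  · exact fun k _ => ENNReal.mul_ne_top (PMF.apply_ne_top _ _) (toOuterMeasure_ne_top _ _)

lemma ResCode.out_eq_output (Ψ : ResCode X) (W : Channel X Y) :
    Ψ.out W = output W (empirical Ψ.size_pos Ψ.pts) :=
  funext fun y => (output_empirical_apply W Ψ.size_pos Ψ.pts y).symm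

end UniformInput

/-! ### Random identification codes -/

section Achievability

variable {X : Type*} {Y : Type*} [Fintype X]

/-- Random identification codes: `N` messages, each encoded by the uniform distribution over
`M` random inputs and decoded by the union of their likelihood ratio sets. -/
lemma exists_idCode (W : Channel X Y) (p : PMF X) {K t : ℝ} {M N : ℕ} (hK : 0 < K) (hM : 0 < M)
    (hN : 0 < N) (ht0 : 0 < t) (ht1 : t ≤ 1) (hMK : 4 * (M / K) ≤ t)
    (hNM : (N : ℝ) ^ 2 * Real.exp (-(M * (t ^ 2 / 2))) < 1) :
    ∃ Φ : IdCode X Y, Φ.size = N ∧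
      Φ.errFirst W ≤ 1 - ratioTail K p W + ENNReal.ofReal t ∧
      Φ.errSecond W ≤ ENNReal.ofReal t := by
  classical
  have hM' : (0 : ℝ) < M := by exact_mod_cast hM
  set w : X → ℝ := fun x => (p x).toReal
  have hw0 (x) : 0 ≤ w x := ENNReal.toReal_nonneg
  have hw : ∑ x, w x = 1 := sum_toReal p
  let D (u : Fin M → X) : Set Y := ⋃ k, ratioSet K p W (u k)
  let f (u : Fin M → X) (x : X) : ℝ := ((W x).toOuterMeasure (D u)).toReal
  let g (x : X) : ℝ := ((W x).toOuterMeasure (ratioSet K p W x)).toReal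
  have hD (u : Fin M → X) : ∑ x, w x * f u x ≤ M / K := by
    have h1 (k : Fin M) :
        ((output W p).toOuterMeasure (ratioSet K p W (u k))).toReal ≤ K⁻¹ := by
      have := ENNReal.toReal_mono ENNReal.one_ne_top
        (mul_toOuterMeasure_ratioSet_le_one K p W (u k))
      rw [ENNReal.toReal_mul, ENNReal.toReal_ofReal hK.le, ENNReal.toReal_one] at this
      rwa [← one_div, le_div_iff₀' hK]
    rw [← toReal_output_toOuterMeasure]
    have h2 : (output W p).toOuterMeasure (D u) ≤
        ∑ k, (output W p).toOuterMeasure (ratioSet K p W (u k)) :=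
      MeasureTheory.measure_iUnion_fintype_le _ _
    calc _ ≤ ∑ k, ((output W p).toOuterMeasure (ratioSet K p W (u k))).toReal := by
          rw [← ENNReal.toReal_sum fun k _ => toOuterMeasure_ne_top _ _]
          exact ENNReal.toReal_mono
            (ENNReal.sum_ne_top.2 fun k _ => toOuterMeasure_ne_top _ _) h2
      _ ≤ ∑ _k : Fin M, K⁻¹ := Finset.sum_le_sum fun k _ => h1 k
      _ = M / K := by simp [div_eq_mul_inv]
  have hW : ∑ u : Fin M → X, ∏ k, w (u k) = 1 := by
    simpa [prodExp] using prodExp_const hw M 1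
  -- The sample space is that of M-tuples, one per message. A tuple is bad if its average ratio
  -- probability is low, a pair if one tuple puts too much mass on the other's region. Since t ≤ 1,
  -- the pair bound exp(-Mt/2) is at most the tuple bound exp(-Mt²/2).
  obtain ⟨c, hcA, hcB⟩ := exists_forall_notMem_and_pairwise
    (w := fun u : Fin M → X => ∏ k, w (u k)) (fun u => Finset.prod_nonneg fun _ _ => hw0 _) hW
    hNM {u | ∑ k, g (u k) < M * (∑ x, w x * g x - t)} (fun u => {v | M * t < ∑ k, f u (v k)})
    (prodExp_indicator_lower hw0 hw (fun _ => ENNReal.toReal_nonneg)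
      (fun _ => toReal_toOuterMeasure_le_one _ _) ht0.le ht1)
    (fun u => (prodExp_indicator_upper hw0 hw (fun _ => ENNReal.toReal_nonneg)
      (fun _ => toReal_toOuterMeasure_le_one _ _)
      ((mul_le_mul_of_nonneg_left (hD u) (by norm_num)).trans hMK)).trans
      (by gcongr; nlinarith))
  refine ⟨⟨N, hN, fun i => empirical hM (c i), fun i => D (c i)⟩, rfl, iSup_le fun i => ?_,
    iSup_le fun i => iSup_le fun j => iSup_le fun hij => ?_⟩
  · have h1 : (ratioTail K p W).toReal - t ≤
        ((output W (empirical hM (c i))).toOuterMeasure (D (c i))).toReal := by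
      rw [toReal_output_empirical, toReal_ratioTail, le_inv_mul_iff₀ hM']
      refine (not_lt.1 (hcA i)).trans (Finset.sum_le_sum fun k _ => ?_)
      exact ENNReal.toReal_mono (toOuterMeasure_ne_top _ _)
        (MeasureTheory.measure_mono (Set.subset_iUnion (fun k => ratioSet K p W (c i k)) k))
    have hT : ratioTail K p W ≠ ∞ := ne_top_of_le_ne_top ENNReal.one_ne_top (ratioTail_le_one ..)
    rw [toOuterMeasure_compl]
    have h2 : ratioTail K p W ≤
        (output W (empirical hM (c i))).toOuterMeasure (D (c i)) + ENNReal.ofReal t := by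
      rw [← ENNReal.ofReal_toReal hT,
        ← ENNReal.ofReal_toReal (toOuterMeasure_ne_top (output W (empirical hM (c i))) (D (c i))),
        ← ENNReal.ofReal_add ENNReal.toReal_nonneg ht0.le]
      exact ENNReal.ofReal_le_ofReal (by linarith)
    rw [tsub_le_iff_right]
    calc (1 : ℝ≥0∞) ≤ 1 - ratioTail K p W + ratioTail K p W := le_tsub_add
      _ ≤ 1 - ratioTail K p W +
          ((output W (empirical hM (c i))).toOuterMeasure (D (c i)) + ENNReal.ofReal t) := by
        gcongr
      _ = _ := by ring
  · change (output W (empirical hM (c j))).toOuterMeasure (D (c i)) ≤ _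
    rw [← ENNReal.ofReal_toReal (toOuterMeasure_ne_top _ _)]
    refine ENNReal.ofReal_le_ofReal ?_
    rw [toReal_output_empirical, inv_mul_le_iff₀ hM']
    exact not_lt.1 (hcB i j hij)

end Achievability

/-! ### Counting resolvability codes -/

section Converse

variable {X : Type*} {Y : Type*}

lemma toOuterMeasure_le_add_tsum_indicator (P Q : PMF Y) (s : Set Y) :
    P.toOuterMeasure s ≤ Q.toOuterMeasure s +
      ∑' y, s.indicator (fun y => ENNReal.ofReal |(P y).toReal - (Q y).toReal|) y := by
  rw [PMF.toOuterMeasure_apply, PMF.toOuterMeasure_apply, ← ENNReal.tsum_add]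
  refine ENNReal.tsum_le_tsum fun y => ?_
  by_cases hy : y ∈ s
  · simp only [Set.indicator_of_mem hy]
    conv_lhs => rw [← ENNReal.ofReal_toReal (P.apply_ne_top y)]
    conv_rhs => enter [1]; rw [← ENNReal.ofReal_toReal (Q.apply_ne_top y)]
    rw [← ENNReal.ofReal_add ENNReal.toReal_nonneg (abs_nonneg _)]
    refine ENNReal.ofReal_le_ofReal ?_
    linarith [le_abs_self ((P y).toReal - (Q y).toReal)]
  · simp [Set.indicator_of_notMem hy]

/-- Probabilities of an event differ by at most half the variational distance. -/
lemma two_mul_toOuterMeasure_le (P Q : PMF Y) (s : Set Y) :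
    2 * P.toOuterMeasure s ≤ 2 * Q.toOuterMeasure s + varDist P Q := by
  have h1 := toOuterMeasure_le_add_tsum_indicator P Q s
  have h2 := toOuterMeasure_le_add_tsum_indicator Q P sᶜ
  simp only [abs_sub_comm (Q _).toReal] at h2
  have h3 : varDist P Q =
      ∑' y, s.indicator (fun y => ENNReal.ofReal |(P y).toReal - (Q y).toReal|) y +
      ∑' y, sᶜ.indicator (fun y => ENNReal.ofReal |(P y).toReal - (Q y).toReal|) y := by
    rw [varDist, ← ENNReal.tsum_add]
    exact tsum_congr fun y => (Set.indicator_self_add_compl_apply s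
      (fun y => ENNReal.ofReal |(P y).toReal - (Q y).toReal|) y).symm
  rw [h3]
  set d₁ := ∑' y, s.indicator (fun y => ENNReal.ofReal |(P y).toReal - (Q y).toReal|) y
  set d₂ := ∑' y, sᶜ.indicator (fun y => ENNReal.ofReal |(P y).toReal - (Q y).toReal|) y
  have hP := toOuterMeasure_add_compl P s
  have hQ := toOuterMeasure_add_compl Q s
  have hPn := toOuterMeasure_ne_top P sᶜ
  have hQn := toOuterMeasure_ne_top Q sᶜ
  -- Adding both complement probabilities lets the deviations on `s` and `sᶜ` be combined without
  -- subtraction.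
  refine (ENNReal.add_le_add_iff_right (ENNReal.add_ne_top.2 ⟨hPn, hQn⟩)).1 ?_
  calc 2 * P.toOuterMeasure s + (P.toOuterMeasure sᶜ + Q.toOuterMeasure sᶜ)
      = P.toOuterMeasure s + (P.toOuterMeasure s + P.toOuterMeasure sᶜ) +
        Q.toOuterMeasure sᶜ := by ring
    _ = P.toOuterMeasure s + (Q.toOuterMeasure s + Q.toOuterMeasure sᶜ) +
        Q.toOuterMeasure sᶜ := by rw [hP, hQ]
    _ ≤ (Q.toOuterMeasure s + d₁) + (Q.toOuterMeasure s + Q.toOuterMeasure sᶜ) +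
        (P.toOuterMeasure sᶜ + d₂) := by gcongr
    _ = _ := by ring

lemma varDist_comm (f g : Y → ℝ≥0∞) : varDist f g = varDist g f :=
  tsum_congr fun y => by rw [abs_sub_comm]

variable [Fintype X]

/-- A code whose messages remain distinguishable after approximating their outputs by
resolvability codes of size at most `L` has no more messages than there are such codes. -/
lemma size_le_of_resErr_lt (W : Channel X Y) (Φ : IdCode X Y) {L : ℝ} {e m l : ℝ≥0∞}
    (hres : resErr L W < e) (hfst : Φ.errFirst W ≤ m) (hsnd : Φ.errSecond W ≤ l)
    (hsum : m + l + e ≤ 1) :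
    1 ≤ L ∧ (Φ.size : ℝ) ≤ L * (Fintype.card X : ℝ) ^ ⌊L⌋₊ := by
  classical
  have hex (i : Fin Φ.size) : ∃ Ψ : ResCode X, (Ψ.size : ℝ) ≤ L ∧
      varDist (Ψ.out W) (output W (Φ.enc i)) < e := by
    have h := lt_of_le_of_lt (le_iSup (fun p : PMF X => ⨅ (Ψ : ResCode X)
      (_ : (Ψ.size : ℝ) ≤ L), varDist (Ψ.out W) (output W p)) (Φ.enc i)) hres
    simpa only [iInf_lt_iff, exists_prop] using h
  have hL : 1 ≤ L := by
    obtain ⟨Ψ, hΨ, -⟩ := hex ⟨0, Φ.size_pos⟩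
    exact le_trans (by exact_mod_cast Ψ.size_pos) hΨ
  refine ⟨hL, ?_⟩
  -- The index s stands for size s + 1, so the sizes run over 1, …, ⌊L⌋.
  let toCode (c : Σ s : Fin ⌊L⌋₊, (Fin (s + 1) → X)) : ResCode X := ⟨c.1 + 1, Nat.succ_pos _, c.2⟩
  have hex' (i : Fin Φ.size) : ∃ c, varDist ((toCode c).out W) (output W (Φ.enc i)) < e := by
    obtain ⟨⟨s, hs, u⟩, hΨ, hd⟩ := hex i
    cases s with
    | zero => exact absurd hs (lt_irrefl 0)
    | succ s => exact ⟨⟨⟨s, Nat.lt_of_succ_le (Nat.le_floor hΨ)⟩, u⟩, hd⟩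
  choose c hc using hex'
  have hinj : Function.Injective c := by
    intro i j hij
    by_contra hne
    set P := output W (empirical (toCode (c i)).size_pos (toCode (c i)).pts)
    have hi := hc i
    have hj := hc j
    rw [← hij] at hj
    rw [ResCode.out_eq_output] at hi hj
    have h1 := two_mul_toOuterMeasure_le (output W (Φ.enc i)) P (Φ.dec i)
    have h2 := two_mul_toOuterMeasure_le P (output W (Φ.enc j)) (Φ.dec i)
    rw [varDist_comm] at h1
    have h3 : 1 ≤ (output W (Φ.enc i)).toOuterMeasure (Φ.dec i) + m := by
      rw [← toOuterMeasure_add_compl (output W (Φ.enc i)) (Φ.dec i)]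
      gcongr
      exact (le_iSup (fun i => (output W (Φ.enc i)).toOuterMeasure (Φ.dec i)ᶜ) i).trans hfst
    have h4 : (output W (Φ.enc j)).toOuterMeasure (Φ.dec i) ≤ l := by
      refine le_trans ?_ hsnd
      exact le_iSup_of_le i (le_iSup_of_le j (le_iSup_of_le hne le_rfl))
    have hfin : 2 * m + 2 * l ≠ ∞ := by
      have : m + l ≠ ∞ := ne_top_of_le_ne_top ENNReal.one_ne_top (le_self_add.trans hsum)
      rw [← mul_add]
      exact ENNReal.mul_ne_top (by norm_num) this
    have h5 : (2 : ℝ≥0∞) * 1 < 2 * 1 := by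
      calc (2 : ℝ≥0∞) * 1 ≤ 2 * ((output W (Φ.enc i)).toOuterMeasure (Φ.dec i) + m) := by gcongr
        _ = 2 * (output W (Φ.enc i)).toOuterMeasure (Φ.dec i) + 2 * m := by ring
        _ ≤ 2 * l + varDist P (output W (Φ.enc j)) + varDist P (output W (Φ.enc i)) + 2 * m := by
          gcongr
          exact h1.trans (add_le_add_left (h2.trans (by gcongr)) _)
        _ = 2 * m + 2 * l + (varDist P (output W (Φ.enc j)) + varDist P (output W (Φ.enc i))) := by
          ring
        _ < 2 * m + 2 * l + (e + e) := ENNReal.add_lt_add_left hfin (ENNReal.add_lt_add hj hi)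
        _ = 2 * (m + l + e) := by ring
        _ ≤ 2 * 1 := by gcongr
    exact lt_irrefl _ h5
  have hX : 0 < Fintype.card X := by
    obtain ⟨x, -⟩ := (Φ.enc ⟨0, Φ.size_pos⟩).support_nonempty
    exact Fintype.card_pos_iff.2 ⟨x⟩
  have hcard := Fintype.card_le_of_injective c hinj
  rw [Fintype.card_fin, Fintype.card_sigma] at hcard
  simp only [Fintype.card_pi, Finset.prod_const, Finset.card_univ, Fintype.card_fin] at hcard
  have hle : Φ.size ≤ ⌊L⌋₊ * Fintype.card X ^ ⌊L⌋₊ := by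
    refine hcard.trans ((Finset.sum_le_card_nsmul _ _ (Fintype.card X ^ ⌊L⌋₊)
      fun s _ => Nat.pow_le_pow_right hX s.2).trans ?_)
    simp
  calc (Φ.size : ℝ) ≤ ⌊L⌋₊ * (Fintype.card X : ℝ) ^ ⌊L⌋₊ := by exact_mod_cast hle
    _ ≤ _ := by
      gcongr
      exact Nat.floor_le (by linarith)

/-- The logarithm of L |X|^⌊L⌋ is at most L (1 + log |X|). A single message is covered because the
right side is nonnegative. -/
lemma logLogSize_le_of_resErr_lt (W : Channel X Y) (Φ : IdCode X Y) {L : ℝ} {e m l : ℝ≥0∞}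
    (hres : resErr L W < e) (hfst : Φ.errFirst W ≤ m) (hsnd : Φ.errSecond W ≤ l)
    (hsum : m + l + e ≤ 1) :
    Φ.logLogSize ≤ Real.log L + Real.log (1 + Real.log (Fintype.card X)) := by
  obtain ⟨hL, hN⟩ := size_le_of_resErr_lt W Φ hres hfst hsnd hsum
  have hc : 0 ≤ Real.log (Fintype.card X) := Real.log_natCast_nonneg _
  have hX : 0 < (Fintype.card X : ℝ) := by
    obtain ⟨x, -⟩ := (Φ.enc ⟨0, Φ.size_pos⟩).support_nonempty
    exact_mod_cast Fintype.card_pos_iff.2 ⟨x⟩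
  rw [IdCode.logLogSize]
  split_ifs with h1
  · exact add_nonneg (Real.log_nonneg hL) (Real.log_nonneg (by linarith))
  have h2 : (1 : ℝ) < Φ.size := by
    have := Φ.size_pos
    exact_mod_cast (by omega : 1 < Φ.size)
  rw [← Real.log_mul (by linarith) (by linarith)]
  refine Real.log_le_log (Real.log_pos h2) ?_
  refine (Real.log_le_log (by linarith) hN).trans ?_
  rw [Real.log_mul (by linarith) (by positivity), Real.log_pow]
  have h3 : Real.log L ≤ L := (Real.log_le_sub_one_of_pos (by linarith)).trans (by linarith)
  have h4 : (⌊L⌋₊ : ℝ) ≤ L := Nat.floor_le (by linarith)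
  nlinarith

end Converse

/-! ### Passing to limits -/

section Limits

open Topology

lemma limsup_liminf_le_two_mul {u T e : ℕ → ℝ≥0∞}
    (h : ∀ᶠ n in atTop, u n ≤ 2 * T n + e n) (he : Tendsto e atTop (𝓝 0)) :
    limsup u atTop ≤ 2 * limsup T atTop ∧ liminf u atTop ≤ 2 * liminf T atTop := by
  have key (δ : ℝ≥0∞) (hδ : 0 < δ) : ∀ᶠ n in atTop, u n ≤ 2 * T n + δ := by
    filter_upwards [h, he.eventually_le_const hδ] with n h1 h2
    exact h1.trans (by gcongr)
  have hmono (δ : ℝ≥0∞) : Monotone fun t : ℝ≥0∞ => 2 * t + δ := fun s t hst => by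
    dsimp only
    gcongr
  have hcont (δ : ℝ≥0∞) : Continuous fun t : ℝ≥0∞ => 2 * t + δ :=
    (ENNReal.continuous_const_mul (by norm_num)).add continuous_const
  constructor
  · refine ENNReal.le_of_forall_pos_le_add fun δ hδ _ => ?_
    rw [(hmono δ).map_limsup_of_continuousAt T (hcont δ).continuousAt]
    exact limsup_le_limsup (key δ (by exact_mod_cast hδ))
  · refine ENNReal.le_of_forall_pos_le_add fun δ hδ _ => ?_
    rw [(hmono δ).map_liminf_of_continuousAt T (hcont δ).continuousAt]
    exact liminf_le_liminf (key δ (by exact_mod_cast hδ))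

/-- The map t ↦ 1 - t + δ is continuous and antitone, hence exchanges limsup and liminf. -/
lemma limsup_liminf_le_one_sub {u T e : ℕ → ℝ≥0∞}
    (h : ∀ᶠ n in atTop, u n ≤ 1 - T n + e n) (he : Tendsto e atTop (𝓝 0)) :
    limsup u atTop ≤ 1 - liminf T atTop ∧ liminf u atTop ≤ 1 - limsup T atTop := by
  have key (δ : ℝ≥0∞) (hδ : 0 < δ) : ∀ᶠ n in atTop, u n ≤ 1 - T n + δ := by
    filter_upwards [h, he.eventually_le_const hδ] with n h1 h2
    exact h1.trans (by gcongr)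
  have hanti (δ : ℝ≥0∞) : Antitone fun t : ℝ≥0∞ => 1 - t + δ := fun s t hst => by
    dsimp only
    gcongr
  have hcont (δ : ℝ≥0∞) : Continuous fun t : ℝ≥0∞ => 1 - t + δ :=
    (ENNReal.continuous_sub_left ENNReal.one_ne_top).add continuous_const
  constructor
  · refine ENNReal.le_of_forall_pos_le_add fun δ hδ _ => ?_
    rw [(hanti δ).map_liminf_of_continuousAt T (hcont δ).continuousAt]
    exact limsup_le_limsup (key δ (by exact_mod_cast hδ))
  · refine ENNReal.le_of_forall_pos_le_add fun δ hδ _ => ?_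
    rw [(hanti δ).map_limsup_of_continuousAt T (hcont δ).continuousAt]
    exact liminf_le_liminf (key δ (by exact_mod_cast hδ))

lemma eventually_mul_sq_le_exp {C h : ℝ} (hC : 0 < C) (hh : 0 < h) :
    ∀ᶠ n : ℕ in atTop, C * (n : ℝ) ^ 2 ≤ Real.exp (n * h) := by
  have h1 := ((isLittleO_pow_exp_pos_mul_atTop 2 hh).comp_tendsto
    tendsto_natCast_atTop_atTop).bound (inv_pos.2 hC)
  filter_upwards [h1] with n hn
  simp only [Function.comp_apply, Real.norm_eq_abs, Real.abs_exp, abs_pow, Nat.abs_cast] at hn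
  rwa [le_inv_mul_iff₀ hC, mul_comm h] at hn

lemma tendsto_ofReal_one_div : Tendsto (fun n : ℕ => ENNReal.ofReal (1 / n)) atTop (nhds 0) := by
  have := ENNReal.tendsto_ofReal tendsto_one_div_atTop_nhds_zero_nat
  rwa [ENNReal.ofReal_zero] at this

/-- A threshold that fails the spectral condition yields an admissible first error; the special
clause at ε = 1 matches the one at μ = 0. -/
lemma first_error_condition {ε : ℝ} (h0 : 0 ≤ ε) (h1 : ε ≤ 1) {c v : ℝ≥0∞}
    (hc : ¬ if ε = 1 then c < 1 else c ≤ ENNReal.ofReal ε) (hv : v ≤ 1 - c) :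
    if 1 - ε = 0 then v = 0 else v < ENNReal.ofReal (1 - ε) := by
  by_cases h : ε = 1
  · rw [if_pos h, not_lt] at hc
    rw [if_pos (by linarith)]
    exact le_antisymm (hv.trans (tsub_eq_zero_of_le hc).le) zero_le
  · rw [if_neg h, not_le] at hc
    rw [if_neg (by contrapose! h; linarith), ENNReal.ofReal_sub _ h0, ENNReal.ofReal_one]
    refine hv.trans_lt ?_
    rcases le_total c 1 with hc1 | hc1
    · rw [lt_tsub_iff_right]
      calc 1 - c + ENNReal.ofReal ε < 1 - c + c :=
            ENNReal.add_lt_add_left (ENNReal.sub_ne_top ENNReal.one_ne_top) hc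
        _ = 1 := tsub_add_cancel_of_le hc1
    · rw [tsub_eq_zero_of_le hc1]
      exact tsub_pos_of_lt (ENNReal.ofReal_lt_one.2 (lt_of_le_of_ne h1 h))

end Limits

/-! ### First inequalities: identification codes from the spectrum -/

section Direct

variable {X : ℕ → Type*} {Y : ℕ → Type*}

lemma limsup_errSecond_le {W : ∀ n, Channel (X n) (Y n)} {Φ : ∀ n, IdCode (X n) (Y n)}
    (h : ∀ᶠ n : ℕ in atTop, (Φ n).errSecond (W n) ≤ ENNReal.ofReal (1 / n)) :
    limsup (fun n => (Φ n).errSecond (W n)) atTop ≤ ENNReal.ofReal 0 := by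
  rw [ENNReal.ofReal_zero, ← tendsto_ofReal_one_div.limsup_eq]
  exact limsup_le_limsup h

/-- The code with a single message, which is always identified. -/
def trivialCode {A B : Type*} (x : A) : IdCode A B :=
  ⟨1, one_pos, fun _ => PMF.pure x, fun _ => Set.univ⟩

lemma errFirst_trivialCode {A B : Type*} (x : A) (V : Channel A B) :
    (trivialCode x).errFirst V = 0 := by
  simp [IdCode.errFirst, trivialCode]

lemma errSecond_trivialCode {A B : Type*} (x : A) (V : Channel A B) :
    (trivialCode x).errSecond V = 0 := by
  refine le_antisymm (iSup_le fun i => iSup_le fun j => iSup_le fun hij => ?_) zero_le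
  exact absurd (Subsingleton.elim (α := Fin 1) i j) hij

variable [∀ n, Fintype (X n)]

lemma eventually_exists_idCode (p : ∀ n, PMF (X n)) (W : ∀ n, Channel (X n) (Y n)) {a b : ℝ}
    (hb : 0 < b) (hab : b < a) :
    ∀ᶠ n : ℕ in atTop, ∃ Φ : IdCode (X n) (Y n),
      Φ.errFirst (W n) ≤ 1 - specTail n (p n) (W n) a + ENNReal.ofReal (1 / n) ∧
      Φ.errSecond (W n) ≤ ENNReal.ofReal (1 / n) ∧ b ≤ 1 / n * Φ.logLogSize := by
  have hh : 0 < (a - b) / 2 := by linarith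
  have hr : 0 < (a + b) / 2 := by linarith
  filter_upwards [eventually_mul_sq_le_exp (C := 8) (by norm_num) hh,
    eventually_mul_sq_le_exp (C := 16) (by norm_num) hr, eventually_ge_atTop 1] with n h1 h2 hn
  have hn' : (1 : ℝ) ≤ n := by exact_mod_cast hn
  have hn0 : (0 : ℝ) < n := by linarith
  -- The tuple length has rate midway between b and a: the upper gap makes M/K negligible, the lower
  -- one absorbs the factor t² = 1/n² in the concentration exponent.
  set E := Real.exp (n * ((a + b) / 2))
  have hE : 16 ≤ E := by nlinarith
  set M := ⌈E⌉₊
  have hM1 : E ≤ M := Nat.le_ceil E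
  have hM2 : (M : ℝ) ≤ 2 * E := (Nat.ceil_lt_add_one (by linarith)).le.trans (by linarith)
  have hM0 : (0 : ℝ) < M := by linarith
  set t : ℝ := 1 / n
  have ht0 : 0 < t := by positivity
  have ht1 : t ≤ 1 := by rwa [div_le_one hn0]
  have htn : t * n = 1 := by simp only [t]; field_simp
  -- The failure bound is exp(-4q), so N ≈ e^q passes the union bound, and q ≥ e^{nb} gives log log
  -- N ≥ nb.
  set q := M * t ^ 2 / 8
  have hqE : E ≤ 8 * (n : ℝ) ^ 2 * q := by
    have : 8 * (n : ℝ) ^ 2 * q = M * (t * n) ^ 2 := by simp only [q]; ring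
    rw [this, htn]
    linarith
  have hq2 : 2 ≤ q := by
    by_contra! hlt
    have : 8 * (n : ℝ) ^ 2 * q < 8 * (n : ℝ) ^ 2 * 2 := by gcongr
    linarith
  have hqb : Real.exp (n * b) ≤ q := by
    have h3 : E = Real.exp (n * ((a - b) / 2)) * Real.exp (n * b) := by
      rw [← Real.exp_add]
      change Real.exp _ = _
      congr 1
      ring
    have h4 : 8 * (n : ℝ) ^ 2 * Real.exp (n * b) ≤ 8 * (n : ℝ) ^ 2 * q := by
      refine le_trans ?_ hqE
      rw [h3]
      gcongr
    exact le_of_mul_le_mul_left h4 (by positivity)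
  set N := ⌈Real.exp q⌉₊
  have hN1 : Real.exp q ≤ N := Nat.le_ceil _
  have hq1 : 1 < Real.exp q := Real.one_lt_exp_iff.2 (by linarith)
  have hN2 : (N : ℝ) ≤ 2 * Real.exp q :=
    (Nat.ceil_lt_add_one (by linarith)).le.trans (by linarith)
  have hN0 : 0 < N := by exact_mod_cast (by linarith : (0 : ℝ) < N)
  have hNM : (N : ℝ) ^ 2 * Real.exp (-(M * (t ^ 2 / 2))) < 1 := by
    have h3 : M * (t ^ 2 / 2) = 4 * q := by simp only [q]; ring
    have h4 : (N : ℝ) ^ 2 ≤ 4 * Real.exp (2 * q) := by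
      calc (N : ℝ) ^ 2 ≤ (2 * Real.exp q) ^ 2 := by gcongr
        _ = _ := by rw [mul_pow, ← Real.exp_nat_mul]; norm_num
    have h5 : 4 < Real.exp (2 * q) := by linarith [Real.add_one_le_exp (2 * q)]
    rw [h3, Real.exp_neg, ← div_eq_mul_inv, div_lt_one (Real.exp_pos _)]
    refine h4.trans_lt ?_
    rw [show 4 * q = 2 * q + 2 * q by ring, Real.exp_add]
    gcongr
  have hMK : 4 * (M / Real.exp (n * a)) ≤ t := by
    have h3 : Real.exp (n * a) = Real.exp (n * ((a - b) / 2)) * E := by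
      rw [← Real.exp_add]
      congr 1
      ring
    rw [← mul_div_assoc, div_le_iff₀ (Real.exp_pos _), h3]
    have h4 : t * (8 * (n : ℝ) ^ 2) * E ≤ t * (Real.exp (n * ((a - b) / 2)) * E) := by
      rw [mul_assoc]
      gcongr
    have h5 : t * (8 * (n : ℝ) ^ 2) * E = 8 * n * E := by
      rw [show t * (8 * (n : ℝ) ^ 2) = 8 * n * (t * n) by ring, htn, mul_one]
    have h6 : 8 * 1 * E ≤ 8 * n * E := by gcongr
    linarith
  obtain ⟨Φ, hsize, hfst, hsnd⟩ := exists_idCode (W n) (p n) (Real.exp_pos (n * a))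
    (by exact_mod_cast hM0) hN0 ht0 ht1 hMK hNM
  refine ⟨Φ, ?_, hsnd, ?_⟩
  · rwa [specTail_eq_ratioTail hn]
  · have hne : Φ.size ≠ 1 := by
      rw [hsize]
      exact_mod_cast (hq1.trans_le hN1).ne'
    change b ≤ 1 / (n : ℝ) * _
    rw [IdCode.logLogSize, if_neg hne, hsize, one_div, le_inv_mul_iff₀ hn0,
      Real.le_log_iff_exp_le (Real.log_pos (hq1.trans_le hN1))]
    exact hqb.trans ((Real.le_log_iff_exp_le (by linarith)).2 hN1)

/-- Identification codes of rate `b` below the spectral threshold `a`. -/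
lemma exists_idCode_seq (p : ∀ n, PMF (X n)) (W : ∀ n, Channel (X n) (Y n)) {a b : ℝ}
    (hab : b < a) :
    ∃ Φ : ∀ n, IdCode (X n) (Y n), ∀ᶠ n : ℕ in atTop,
      (Φ n).errFirst (W n) ≤ 1 - specTail n (p n) (W n) a + ENNReal.ofReal (1 / n) ∧
      (Φ n).errSecond (W n) ≤ ENNReal.ofReal (1 / n) ∧ b ≤ 1 / n * (Φ n).logLogSize := by
  classical
  have hne (n) : Nonempty (X n) := let ⟨x, _⟩ := (p n).support_nonempty; ⟨x⟩
  rcases le_or_gt b 0 with hb | hb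
  -- One message has rate 0 ≥ b by the convention for log log 1.
  · refine ⟨fun n => trivialCode (Classical.arbitrary (X n)), Eventually.of_forall fun n => ?_⟩
    rw [errFirst_trivialCode, errSecond_trivialCode]
    exact ⟨zero_le, zero_le, by simpa [IdCode.logLogSize, trivialCode] using hb⟩
  · have h (n : ℕ) : ∃ Φ : IdCode (X n) (Y n), (∃ Φ : IdCode (X n) (Y n),
        Φ.errFirst (W n) ≤ 1 - specTail n (p n) (W n) a + ENNReal.ofReal (1 / n) ∧
        Φ.errSecond (W n) ≤ ENNReal.ofReal (1 / n) ∧ b ≤ 1 / n * Φ.logLogSize) →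
        (Φ.errFirst (W n) ≤ 1 - specTail n (p n) (W n) a + ENNReal.ofReal (1 / n) ∧
        Φ.errSecond (W n) ≤ ENNReal.ofReal (1 / n) ∧ b ≤ 1 / n * Φ.logLogSize) := by
      by_cases hΦ : ∃ Φ : IdCode (X n) (Y n),
        Φ.errFirst (W n) ≤ 1 - specTail n (p n) (W n) a + ENNReal.ofReal (1 / n) ∧
        Φ.errSecond (W n) ≤ ENNReal.ofReal (1 / n) ∧ b ≤ 1 / n * Φ.logLogSize
      · exact ⟨hΦ.choose, fun _ => hΦ.choose_spec⟩
      · exact ⟨trivialCode (Classical.arbitrary (X n)), fun h => absurd h hΦ⟩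
    choose Φ hΦ using h
    exact ⟨Φ, (eventually_exists_idCode p W hb hab).mono fun n hn => hΦ n hn⟩

lemma iSup_specInf_le_idCap (W : ∀ n, Channel (X n) (Y n)) {ε : ℝ} (h0 : 0 ≤ ε) (h1 : ε ≤ 1) :
    ⨆ p : ∀ n, PMF (X n), specInf ε p W ≤ idCap (1 - ε) 0 W := by
  refine iSup_le fun p => EReal.ge_of_forall_gt_iff_ge.1 fun b hb => ?_
  obtain ⟨a, hba, ha⟩ := EReal.lt_iff_exists_real_btwn.1 hb
  obtain ⟨Φ, hΦ⟩ := exists_idCode_seq p W (EReal.coe_lt_coe_iff.1 hba)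
  have hc : ¬ if ε = 1 then liminf (fun n => specTail n (p n) (W n) a) atTop < 1
      else liminf (fun n => specTail n (p n) (W n) a) atTop ≤ ENNReal.ofReal ε :=
    fun hc => not_le.2 ha (iInf₂_le a hc)
  refine le_iSup_of_le Φ (le_iSup_of_le ?_ (le_iSup_of_le ?_ ?_))
  · exact first_error_condition h0 h1 hc
      (limsup_liminf_le_one_sub (hΦ.mono fun n hn => hn.1) tendsto_ofReal_one_div).1
  · exact limsup_errSecond_le (hΦ.mono fun n hn => hn.2.1)
  · exact le_liminf_of_le (by isBoundedDefault)
      (hΦ.mono fun n hn => EReal.coe_le_coe_iff.2 hn.2.2)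

lemma iSup_specSup_le_idCapDagger (W : ∀ n, Channel (X n) (Y n)) {ε : ℝ} (h0 : 0 ≤ ε)
    (h1 : ε ≤ 1) :
    ⨆ p : ∀ n, PMF (X n), specSup ε p W ≤ idCapDagger (1 - ε) 0 W := by
  refine iSup_le fun p => EReal.ge_of_forall_gt_iff_ge.1 fun b hb => ?_
  obtain ⟨a, hba, ha⟩ := EReal.lt_iff_exists_real_btwn.1 hb
  obtain ⟨Φ, hΦ⟩ := exists_idCode_seq p W (EReal.coe_lt_coe_iff.1 hba)
  have hc : ¬ if ε = 1 then limsup (fun n => specTail n (p n) (W n) a) atTop < 1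
      else limsup (fun n => specTail n (p n) (W n) a) atTop ≤ ENNReal.ofReal ε :=
    fun hc => not_le.2 ha (iInf₂_le a hc)
  refine le_iSup_of_le Φ (le_iSup_of_le ?_ (le_iSup_of_le ?_ ?_))
  · exact first_error_condition h0 h1 hc
      (limsup_liminf_le_one_sub (hΦ.mono fun n hn => hn.1) tendsto_ofReal_one_div).2
  · exact limsup_errSecond_le (hΦ.mono fun n hn => hn.2.1)
  · exact le_liminf_of_le (by isBoundedDefault)
      (hΦ.mono fun n hn => EReal.coe_le_coe_iff.2 hn.2.2)

end Direct

/-! ### Second inequalities: identification against resolvability -/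

section ConverseSeq

variable {X : ℕ → Type*} {Y : ℕ → Type*} [∀ n, Fintype (X n)]

/-- With L = e^{nR} and |X| = d^n the counting bound is nR + log(1 + n log d). Bounding a liminf
requires this only infinitely often, so the same statement serves both chains. -/
lemma liminf_logLogSize_le {d : ℕ} (hX : ∀ n, Fintype.card (X n) = d ^ n)
    {W : ∀ n, Channel (X n) (Y n)} {Φ : ∀ n, IdCode (X n) (Y n)} {R : ℝ} {e m l : ℝ≥0∞}
    (hsum : m + l + e ≤ 1)
    (h : ∃ᶠ n : ℕ in atTop, resErr (Real.exp (n * R)) (W n) < e ∧ (Φ n).errFirst (W n) < m)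
    (hl : ∀ᶠ n in atTop, (Φ n).errSecond (W n) < l) :
    liminf (fun n : ℕ => ((1 / (n : ℝ) * (Φ n).logLogSize : ℝ) : EReal)) atTop ≤ R := by
  refine EReal.le_of_forall_lt_iff_le.1 fun z hz => ?_
  have hzR : 0 < z - R := sub_pos.2 (EReal.coe_lt_coe_iff.1 hz)
  have hd : 0 ≤ Real.log d := Real.log_natCast_nonneg d
  refine liminf_le_of_frequently_le ?_ (by isBoundedDefault)
  refine ((h.and_eventually hl).and_eventually ((eventually_mul_sq_le_exp
    (C := 1 + Real.log d) (by linarith) hzR).and (eventually_ge_atTop 1))).mono ?_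
  rintro n ⟨⟨⟨hres, hfst⟩, hsnd⟩, hexp, hn⟩
  have hn' : (1 : ℝ) ≤ n := by exact_mod_cast hn
  have h1 := logLogSize_le_of_resErr_lt (W n) (Φ n) hres hfst.le hsnd.le hsum
  rw [Real.log_exp, hX, Nat.cast_pow, Real.log_pow] at h1
  have h2 : Real.log (1 + n * Real.log d) ≤ n * (z - R) := by
    rw [Real.log_le_iff_le_exp (by positivity)]
    refine le_trans ?_ hexp
    have h3 : (n : ℝ) ≤ (n : ℝ) ^ 2 := le_self_pow₀ hn' two_ne_zero
    nlinarith [mul_le_mul_of_nonneg_right h3 hd]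
  rw [EReal.coe_le_coe_iff, one_div, inv_mul_le_iff₀ (by linarith)]
  linarith

/-- The gap left by m + ε < 1 is shared equally between strict slack for the resolvability error and
a positive bound on the second error. -/
lemma exists_error_margins {ε : ℝ} (h0 : 0 ≤ ε) (h1 : ε < 1) {c v : ℝ≥0∞}
    (hc : if ε = 2 then c < 2 else c ≤ ENNReal.ofReal ε)
    (hv : if 1 - ε = 0 then v = 0 else v < ENNReal.ofReal (1 - ε)) :
    ∃ e m l : ℝ≥0∞, m + l + e ≤ 1 ∧ c < e ∧ v < m ∧ 0 < l := by
  rw [if_neg (by linarith)] at hc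
  rw [if_neg (by linarith)] at hv
  obtain ⟨m, hvm, hm⟩ := exists_between hv
  have hlt : m + ENNReal.ofReal ε < 1 := by
    rw [ENNReal.ofReal_sub _ h0, ENNReal.ofReal_one] at hm
    exact lt_tsub_iff_right.1 hm
  have hg : 1 - (m + ENNReal.ofReal ε) ≠ 0 := (tsub_pos_of_lt hlt).ne'
  refine ⟨ENNReal.ofReal ε + (1 - (m + ENNReal.ofReal ε)) / 2, m,
    (1 - (m + ENNReal.ofReal ε)) / 2, ?_, ?_, hvm, ENNReal.half_pos hg⟩
  · calc _ = m + ENNReal.ofReal ε +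
          ((1 - (m + ENNReal.ofReal ε)) / 2 + (1 - (m + ENNReal.ofReal ε)) / 2) := by ring
      _ = 1 := by rw [ENNReal.add_halves, add_tsub_cancel_of_le hlt.le]
      _ ≤ 1 := le_rfl
  · exact hc.trans_lt (ENNReal.lt_add_right ENNReal.ofReal_ne_top (ENNReal.half_pos hg).ne')

lemma idCap_le_resCapDagger {d : ℕ} (hX : ∀ n, Fintype.card (X n) = d ^ n)
    (W : ∀ n, Channel (X n) (Y n)) {ε : ℝ} (h0 : 0 ≤ ε) (h1 : ε < 1) :
    idCap (1 - ε) 0 W ≤ resCapDagger ε W := by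
  refine iSup_le fun Φ => iSup_le fun hfst => iSup_le fun hsnd => le_iInf₂ fun R hR => ?_
  obtain ⟨e, m, l, hsum, he, hm, hl⟩ := exists_error_margins h0 h1 hR hfst
  rw [ENNReal.ofReal_zero] at hsnd
  exact liminf_logLogSize_le hX hsum
    ((frequently_lt_of_liminf_lt (by isBoundedDefault) he).and_eventually
      (eventually_lt_of_limsup_lt hm)) (eventually_lt_of_limsup_lt (hsnd.trans_lt hl))

lemma idCapDagger_le_resCap {d : ℕ} (hX : ∀ n, Fintype.card (X n) = d ^ n)
    (W : ∀ n, Channel (X n) (Y n)) {ε : ℝ} (h0 : 0 ≤ ε) (h1 : ε < 1) :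
    idCapDagger (1 - ε) 0 W ≤ resCap ε W := by
  refine iSup_le fun Φ => iSup_le fun hfst => iSup_le fun hsnd => le_iInf₂ fun R hR => ?_
  obtain ⟨e, m, l, hsum, he, hm, hl⟩ := exists_error_margins h0 h1 hR hfst
  rw [ENNReal.ofReal_zero] at hsnd
  exact liminf_logLogSize_le hX hsum
    (((frequently_lt_of_liminf_lt (by isBoundedDefault) hm).and_eventually
      (eventually_lt_of_limsup_lt he)).mono fun n hn => hn.symm)
    (eventually_lt_of_limsup_lt (hsnd.trans_lt hl))

end ConverseSeq

/-! ### Third inequalities: resolvability from the spectrum -/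

section Resolvability

variable {X : ℕ → Type*} {Y : ℕ → Type*} [∀ n, Fintype (X n)]

/-- Off the ratio set W_x is at most K W_p, so the complement has mass at most K. -/
lemma one_le_ratioTail_add {A B : Type*} [Fintype A] (K : ℝ) (p : PMF A) (V : Channel A B) :
    1 ≤ ratioTail K p V + ENNReal.ofReal K := by
  have h (x : A) : (V x).toOuterMeasure (ratioSet K p V x)ᶜ ≤ ENNReal.ofReal K := by
    rw [PMF.toOuterMeasure_apply]
    calc _ ≤ ∑' y, ENNReal.ofReal K * output V p y := ENNReal.tsum_le_tsum fun y => by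
          by_cases hy : y ∈ ratioSet K p V x
          · simp [hy]
          · rw [Set.indicator_of_mem hy]
            exact not_lt.1 hy
      _ = _ := by rw [ENNReal.tsum_mul_left, PMF.tsum_coe, mul_one]
  have hp : ∑ x, p x = 1 := by rw [← tsum_fintype (L := .unconditional A), p.tsum_coe]
  calc (1 : ℝ≥0∞) = ∑ x, p x * ((V x).toOuterMeasure (ratioSet K p V x) +
        (V x).toOuterMeasure (ratioSet K p V x)ᶜ) := by
        simp [toOuterMeasure_add_compl, hp]
    _ ≤ ∑ x, p x * ((V x).toOuterMeasure (ratioSet K p V x) + ENNReal.ofReal K) := by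
        gcongr with x
        exact h x
    _ = _ := by
        simp only [mul_add, Finset.sum_add_distrib, ← Finset.sum_mul, hp, one_mul]
        rfl

/-- This rules out negative spectral thresholds, hence negative rates R, for which no resolvability
code would be small enough. -/
lemma one_le_liminf_specTail (p : ∀ n, PMF (X n)) (W : ∀ n, Channel (X n) (Y n)) {a : ℝ}
    (ha : a < 0) : 1 ≤ liminf (fun n => specTail n (p n) (W n) a) atTop := by
  have hlim : Tendsto (fun n : ℕ => 1 - ENNReal.ofReal (Real.exp (n * a))) atTop (nhds 1) := by
    have h1 : Tendsto (fun n : ℕ => Real.exp (n * a)) atTop (nhds 0) :=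
      Real.tendsto_exp_atBot.comp (tendsto_natCast_atTop_atTop.atTop_mul_const_of_neg ha)
    have h2 := ENNReal.Tendsto.sub (tendsto_const_nhds (x := (1 : ℝ≥0∞)) (f := atTop))
      (ENNReal.tendsto_ofReal h1) (Or.inl ENNReal.one_ne_top)
    simpa using h2
  rw [← hlim.liminf_eq]
  refine liminf_le_liminf ((eventually_ge_atTop 1).mono fun n hn => ?_)
  rw [specTail_eq_ratioTail hn]
  exact tsub_le_iff_right.2 (one_le_ratioTail_add _ _ _)

/-- The inputs `p` are nearly worst for resolvability, within 1/n, and do not depend on `a`; so `a`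
may later be chosen according to the spectrum of `p`. -/
lemma exists_resErr_le_specTail [∀ n, Nonempty (X n)] (W : ∀ n, Channel (X n) (Y n)) {R : ℝ}
    (hR : 0 ≤ R) :
    ∃ p : ∀ n, PMF (X n), ∀ a < R, ∃ e : ℕ → ℝ≥0∞, Tendsto e atTop (nhds 0) ∧
      ∀ᶠ n : ℕ in atTop,
        resErr (Real.exp (n * R)) (W n) ≤ 2 * specTail n (p n) (W n) a + e n := by
  choose p hp using fun n : ℕ => exists_resErr_le (W n)
    (Real.one_le_exp (mul_nonneg n.cast_nonneg hR)) (δ := (n : ℝ≥0∞)⁻¹) (by simp)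
  refine ⟨p, fun a ha => ⟨fun n => ENNReal.ofReal √(2 * Real.exp (n * a) / Real.exp (n * R)) +
    (n : ℝ≥0∞)⁻¹, ?_, ?_⟩⟩
  · have h1 : Tendsto (fun n : ℕ => 2 * Real.exp (n * a) / Real.exp (n * R)) atTop (nhds 0) := by
      have h2 : Tendsto (fun n : ℕ => 2 * Real.exp (n * (a - R))) atTop (nhds (2 * 0)) :=
        (Real.tendsto_exp_atBot.comp
          (tendsto_natCast_atTop_atTop.atTop_mul_const_of_neg (sub_neg.2 ha))).const_mul 2
      rw [mul_zero] at h2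
      refine h2.congr fun n => ?_
      rw [mul_sub, Real.exp_sub, mul_div_assoc]
    have h3 := (ENNReal.tendsto_ofReal h1.sqrt).add ENNReal.tendsto_inv_nat_nhds_zero
    simpa using h3
  · filter_upwards [eventually_ge_atTop 1] with n hn
    rw [specTail_eq_ratioTail hn, ← add_assoc]
    exact hp n _ (Real.exp_pos _).le

lemma not_tail_condition {ε : ℝ} (h1 : ε ≤ 1) {c : ℝ≥0∞} (hc : 1 ≤ c) :
    ¬ if ε = 1 then c < 1 else c ≤ ENNReal.ofReal ε := by
  split_ifs with h
  · exact not_lt.2 hc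
  · exact not_le.2 ((ENNReal.ofReal_lt_one.2 (lt_of_le_of_ne h1 h)).trans_le hc)

lemma resErr_condition {ε : ℝ} {c v : ℝ≥0∞}
    (hc : if ε / 2 = 1 then c < 1 else c ≤ ENNReal.ofReal (ε / 2)) (hv : v ≤ 2 * c) :
    if ε = 2 then v < 2 else v ≤ ENNReal.ofReal ε := by
  by_cases h : ε = 2
  · rw [if_pos (by linarith)] at hc
    rw [if_pos h]
    refine hv.trans_lt ?_
    calc 2 * c < 2 * 1 := ENNReal.mul_lt_mul_right (by norm_num) (by norm_num) hc
      _ = 2 := mul_one 2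
  · rw [if_neg (by contrapose! h; linarith)] at hc
    rw [if_neg h]
    calc v ≤ 2 * ENNReal.ofReal (ε / 2) := hv.trans (by gcongr)
      _ = ENNReal.ofReal ε := by
        rw [← ENNReal.ofReal_ofNat 2, ← ENNReal.ofReal_mul zero_le_two]
        congr 1
        ring

lemma resCapDagger_le_iSup_specInf [∀ n, Nonempty (X n)] (W : ∀ n, Channel (X n) (Y n)) {ε : ℝ}
    (h2 : ε ≤ 2) :
    resCapDagger ε W ≤ ⨆ p : ∀ n, PMF (X n), specInf (ε / 2) p W := by
  refine EReal.le_of_forall_lt_iff_le.1 fun R hR => ?_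
  have hlt (p : ∀ n, PMF (X n)) : ∃ a < R, 0 ≤ a ∧
      if ε / 2 = 1 then liminf (fun n => specTail n (p n) (W n) a) atTop < 1
      else liminf (fun n => specTail n (p n) (W n) a) atTop ≤ ENNReal.ofReal (ε / 2) := by
    obtain ⟨a, ha⟩ := iInf_lt_iff.1 ((le_iSup (fun p => specInf (ε / 2) p W) p).trans_lt hR)
    obtain ⟨hc, ha⟩ := iInf_lt_iff.1 ha
    refine ⟨a, EReal.coe_lt_coe_iff.1 ha, ?_, hc⟩
    by_contra! ha0
    exact not_tail_condition (by linarith) (one_le_liminf_specTail p W ha0) hc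
  -- An arbitrary input sequence serves only to show R ≥ 0, before the nearly worst one is chosen.
  obtain ⟨a₀, ha₀, ha₀', -⟩ := hlt fun n => PMF.pure (Classical.arbitrary (X n))
  obtain ⟨p, hp⟩ := exists_resErr_le_specTail W (ha₀'.trans ha₀.le)
  obtain ⟨a, ha, -, hc⟩ := hlt p
  obtain ⟨e, he, hle⟩ := hp a ha
  exact iInf₂_le R (resErr_condition hc (limsup_liminf_le_two_mul hle he).2)

lemma resCap_le_iSup_specSup [∀ n, Nonempty (X n)] (W : ∀ n, Channel (X n) (Y n)) {ε : ℝ}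
    (h2 : ε ≤ 2) :
    resCap ε W ≤ ⨆ p : ∀ n, PMF (X n), specSup (ε / 2) p W := by
  refine EReal.le_of_forall_lt_iff_le.1 fun R hR => ?_
  have hlt (p : ∀ n, PMF (X n)) : ∃ a < R, 0 ≤ a ∧
      if ε / 2 = 1 then limsup (fun n => specTail n (p n) (W n) a) atTop < 1
      else limsup (fun n => specTail n (p n) (W n) a) atTop ≤ ENNReal.ofReal (ε / 2) := by
    obtain ⟨a, ha⟩ := iInf_lt_iff.1 ((le_iSup (fun p => specSup (ε / 2) p W) p).trans_lt hR)
    obtain ⟨hc, ha⟩ := iInf_lt_iff.1 ha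
    refine ⟨a, EReal.coe_lt_coe_iff.1 ha, ?_, hc⟩
    by_contra! ha0
    exact not_tail_condition (by linarith)
      ((one_le_liminf_specTail p W ha0).trans liminf_le_limsup) hc
  obtain ⟨a₀, ha₀, ha₀', -⟩ := hlt fun n => PMF.pure (Classical.arbitrary (X n))
  obtain ⟨p, hp⟩ := exists_resErr_le_specTail W (ha₀'.trans ha₀.le)
  obtain ⟨a, ha, -, hc⟩ := hlt p
  obtain ⟨e, he, hle⟩ := hp a ha
  exact iInf₂_le R (resErr_condition hc (limsup_liminf_le_two_mul hle he).1)

end Resolvability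

end IdRes

end

theorem theorem3 {X : ℕ → Type*} {Y : ℕ → Type*} [∀ n, Fintype (X n)]
    (d : ℕ) (hd : 0 < d) (hX : ∀ n, Fintype.card (X n) = d ^ n)
    (W : ∀ n, IdRes.Channel (X n) (Y n)) :
    -- the chain for the liminf version
    (∀ ε : ℝ, 0 ≤ ε → ε ≤ 1 →
      (⨆ p : ∀ n, PMF (X n), IdRes.specInf ε p W) ≤ IdRes.idCap (1 - ε) 0 W) ∧
    (∀ ε : ℝ, 0 ≤ ε → ε < 1 →
      IdRes.idCap (1 - ε) 0 W ≤ IdRes.resCapDagger ε W) ∧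
    (∀ ε : ℝ, 0 ≤ ε → ε ≤ 2 →
      IdRes.resCapDagger ε W ≤ ⨆ p : ∀ n, PMF (X n), IdRes.specInf (ε / 2) p W) ∧
    -- the chain for the limsup version
    (∀ ε : ℝ, 0 ≤ ε → ε ≤ 1 →
      (⨆ p : ∀ n, PMF (X n), IdRes.specSup ε p W) ≤ IdRes.idCapDagger (1 - ε) 0 W) ∧
    (∀ ε : ℝ, 0 ≤ ε → ε < 1 →
      IdRes.idCapDagger (1 - ε) 0 W ≤ IdRes.resCap ε W) ∧
    (∀ ε : ℝ, 0 ≤ ε → ε ≤ 2 →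
      IdRes.resCap ε W ≤ ⨆ p : ∀ n, PMF (X n), IdRes.specSup (ε / 2) p W) ∧
    -- equality at zero
    ((⨆ p : ∀ n, PMF (X n), IdRes.specInf 0 p W) = IdRes.idCap 1 0 W ∧
      IdRes.idCap 1 0 W = IdRes.resCapDagger 0 W) ∧
    ((⨆ p : ∀ n, PMF (X n), IdRes.specSup 0 p W) = IdRes.idCapDagger 1 0 W ∧
      IdRes.idCapDagger 1 0 W = IdRes.resCap 0 W) := by
  have hne (n) : Nonempty (X n) :=
    Fintype.card_pos_iff.1 (by rw [hX]; exact Nat.pow_pos hd)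
  -- At ε = 0 the levels ε and ε/2 agree, so each chain closes into a cycle.
  have a1 := IdRes.iSup_specInf_le_idCap W le_rfl zero_le_one
  have a2 := IdRes.idCap_le_resCapDagger hX W le_rfl zero_lt_one
  have a3 := IdRes.resCapDagger_le_iSup_specInf W (ε := 0) zero_le_two
  have b1 := IdRes.iSup_specSup_le_idCapDagger W le_rfl zero_le_one
  have b2 := IdRes.idCapDagger_le_resCap hX W le_rfl zero_lt_one
  have b3 := IdRes.resCap_le_iSup_specSup W (ε := 0) zero_le_two
  rw [sub_zero] at a1 a2 b1 b2
  rw [zero_div] at a3 b3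
  exact ⟨fun ε h0 h1 => IdRes.iSup_specInf_le_idCap W h0 h1,
    fun ε h0 h1 => IdRes.idCap_le_resCapDagger hX W h0 h1,
    fun ε _ h2 => IdRes.resCapDagger_le_iSup_specInf W h2,
    fun ε h0 h1 => IdRes.iSup_specSup_le_idCapDagger W h0 h1,
    fun ε h0 h1 => IdRes.idCapDagger_le_resCap hX W h0 h1,
    fun ε _ h2 => IdRes.resCap_le_iSup_specSup W h2,
    ⟨a1.antisymm (a2.trans a3), a2.antisymm (a3.trans a1)⟩,
    ⟨b1.antisymm (b2.trans b3), b2.antisymm (b3.trans b1)⟩⟩
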